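/- Let $d\ge 1$ be an integer and let $\lambda,\alpha>0$. For $x\in\mathbb Z^d$ write $|x|$ for the $\ell^1$-norm. Scale-free percolation on $\mathbb Z^d$ is the following random graph with vertex set $\mathbb Z^d$: the vertices carry i.i.d. real weights $(W_x)_{x\in\mathbb Z^d}$ with common law $W$, and, conditionally on the weights, each edge $\{x,y\}$ with $x\neq y$ is open, independently of all other edges, with probability $$p_{xy}=1-\exp\left(-\lambda\,\frac{W_xW_y}{|x-y|^{\alpha}}\right).$$ Suppose that for some $\tau>1$ and some $c>0$ the law of the weights satisfies $$\mathbb P(W\ge w)\ \ge\ \min\{c\,w^{-(\tau-1)},\,1\}\qquad\text{for all } w>0 .$$ (In particular the weights are almost surely bounded away from $0$.) Put $\gamma=\alpha(\tau-1)/d$. The diameter of a connected component of the graph of open edges is the maximal graph distance between two of its vertices. 1. If $\gamma\le 1$, then almost surely there is exactly one infinite connected component $\mathcal C$, and $\operatorname{diam}\mathcal C=2$. 2. If $\alpha<d$, then almost surely there is exactly one infinite connected component $\mathcal C$, and $\operatorname{diam}\mathcal C\le\lceil d/(d-\alpha)\rceil$. -/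

import Mathlib

open MeasureTheory ProbabilityTheory

namespace ScaleFreePercolation

/-- The `ℓ¹`-distance `|x - y|` on `ℤ^d`. -/
def l1Dist {d : ℕ} (x y : Fin d → ℤ) : ℝ := ∑ i, |(x i : ℝ) - (y i : ℝ)|

theorem l1Dist_comm {d : ℕ} (x y : Fin d → ℤ) : l1Dist x y = l1Dist y x :=
  Finset.sum_congr rfl fun _ _ => abs_sub_comm _ _

/-- The quantity `1 - exp (-(lam * (W_x * W_y / |x - y| ^ α)))` attached to the unordered pair
`e = {x, y}`, as a function of the weights `W`. -/
noncomputable def edgeFun {d : ℕ} (lam α : ℝ) (W : (Fin d → ℤ) → ℝ) (e : Sym2 (Fin d → ℤ)) : ℝ :=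
  Sym2.lift ⟨fun x y => 1 - Real.exp (-(lam * (W x * W y / l1Dist x y ^ α))), fun x y => by
    simp only [l1Dist_comm x y, mul_comm (W x) (W y)]⟩ e

/-- The retention probability `p_{xy}` as an element of `[0, 1]`. For `lam ≥ 0` and nonnegative
weights the truncation to `[0, 1]` does nothing. -/
noncomputable def edgeProb {d : ℕ} (lam α : ℝ) (W : (Fin d → ℤ) → ℝ) (e : Sym2 (Fin d → ℤ)) :
    unitInterval :=
  Set.projIcc 0 1 zero_le_one (edgeFun lam α W e)

theorem measurable_edgeProb {d : ℕ} (lam α : ℝ) (e : Sym2 (Fin d → ℤ)) :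
    Measurable fun W : (Fin d → ℤ) → ℝ => edgeProb lam α W e := by
  refine continuous_projIcc.measurable.comp ?_
  induction e using Sym2.ind with
  | _ x y =>
    simp only [edgeFun, Sym2.lift_mk]
    fun_prop

/-- The conditional law of the edge configuration given the weights `W`: every edge `e` is open
(`true`) with probability `edgeProb lam α W e`, independently of all other edges. -/
noncomputable def edgeMeasure {d : ℕ} (lam α : ℝ) (W : (Fin d → ℤ) → ℝ) :
    Measure (Sym2 (Fin d → ℤ) → Bool) :=
  Measure.infinitePi fun e => bernoulliMeasure true false (edgeProb lam α W e)

instance isProbabilityMeasure_edgeMeasure {d : ℕ} (lam α : ℝ) (W : (Fin d → ℤ) → ℝ) :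
    IsProbabilityMeasure (edgeMeasure lam α W) := by
  unfold edgeMeasure
  infer_instance

theorem measurable_edgeMeasure {d : ℕ} (lam α : ℝ) :
    Measurable fun W : (Fin d → ℤ) → ℝ => edgeMeasure lam α W := by
  classical
  refine Measurable.measure_of_isPiSystem_of_isProbabilityMeasure
    (generateFrom_squareCylinders (α := fun _ : Sym2 (Fin d → ℤ) => Bool)).symm
    (isPiSystem_squareCylinders (fun _ => MeasurableSpace.isPiSystem_measurableSet) (by simp)) ?_
  rintro _ ⟨s, t, ht, rfl⟩
  have ht' : ∀ e, MeasurableSet (t e) := fun e => ht e (Set.mem_univ e)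
  have heq : (fun W : (Fin d → ℤ) → ℝ => edgeMeasure lam α W ((s : Set _).pi t)) =
      fun W => ∏ e ∈ s, bernoulliMeasure true false (edgeProb lam α W e) (t e) := by
    funext W
    exact Measure.infinitePi_pi _ fun e _ => ht' e
  rw [heq]
  refine Finset.measurable_prod _ fun e _ => ?_
  have h := measurable_edgeProb lam α e
  simp only [bernoulliMeasure_def, Measure.add_apply, Measure.smul_apply]
  simp only [ENNReal.smul_def, smul_eq_mul]
  have h1 : Measurable fun W => unitInterval.toNNReal (edgeProb lam α W e) :=
    unitInterval.toNNReal_continuous.measurable.comp h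
  have h2 : Measurable fun W => unitInterval.toNNReal (unitInterval.symm (edgeProb lam α W e)) :=
    unitInterval.toNNReal_continuous.measurable.comp
      (unitInterval.continuous_symm.measurable.comp h)
  fun_prop

/-- `edgeMeasure` as a Markov kernel from weight configurations to edge configurations. -/
noncomputable def edgeKernel (d : ℕ) (lam α : ℝ) :
    Kernel ((Fin d → ℤ) → ℝ) (Sym2 (Fin d → ℤ) → Bool) where
  toFun := edgeMeasure lam α
  measurable' := measurable_edgeMeasure lam α

instance isMarkovKernel_edgeKernel (d : ℕ) (lam α : ℝ) : IsMarkovKernel (edgeKernel d lam α) :=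
  ⟨fun W => isProbabilityMeasure_edgeMeasure lam α W⟩

/-- The joint law of the weights and the edge occupation in scale-free percolation on `ℤ^d`: the
weights are i.i.d. with law `μ` and, conditionally on them, the edges have law `edgeMeasure`. -/
noncomputable def sfpMeasure (d : ℕ) (lam α : ℝ) (μ : Measure ℝ) [IsProbabilityMeasure μ] :
    Measure (((Fin d → ℤ) → ℝ) × (Sym2 (Fin d → ℤ) → Bool)) :=
  (Measure.infinitePi fun _ : Fin d → ℤ => μ) ⊗ₘ edgeKernel d lam α

instance isProbabilityMeasure_sfpMeasure (d : ℕ) (lam α : ℝ) (μ : Measure ℝ)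
    [IsProbabilityMeasure μ] : IsProbabilityMeasure (sfpMeasure d lam α μ) := by
  unfold sfpMeasure
  infer_instance

/-- The graph on `ℤ^d` formed by the open edges; pairs `{x, x}` are ignored. -/
def openGraph {d : ℕ} (η : Sym2 (Fin d → ℤ) → Bool) : SimpleGraph (Fin d → ℤ) :=
  SimpleGraph.fromEdgeSet {e | η e = true}

end ScaleFreePercolation

/-! The tail bound equals `1` at `w = c ^ (1 / (τ - 1))`, so all weights are almost surely at least
this positive constant. In both parts it then suffices to bound the distance of each fixed pair `x ≠
y` almost surely: there are countably many pairs, so the whole graph is almost surely connected,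
with the same bound on its diameter.

For `γ ≤ 1`, the dyadic box of side `2 ^ n` has `2 ^ (n d)` vertices, so with probability bounded
below it contains a hub of weight at least `2 ^ (n α)`. The boxes are disjoint, and the second
Borel–Cantelli lemma gives infinitely many hubs (`ae_frequently_exists_large_weight`). A hub's
weight compensates its distance to `x` and `y`, so given the weights each hub is a common neighbour
with probability bounded below, and Borel–Cantelli applies again (`ae_exists_common_neighbour`). The
diameter is not smaller than `2`, since among infinitely many disjoint pairs of vertices with
bounded weights some edge is closed (`ae_exists_closed_edge`).

For `α < d`, only the lower bound on the weights is used: an edge of length `r` is open with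
probability at least `1 - exp (-κ / r ^ α)`. Put `m + 1 = ⌈d / (d - α)⌉` and look for paths from `x`
to `y` through `m` consecutive dyadic boxes at scale `R`. The number of boxes' vertices reached
grows by a factor of order `R ^ (d - α)` per step, and after `m` steps it is at least of order `R ^
α`, enough to hit `y` with probability bounded below. The growth is controlled through Laplace
transforms, layer by layer (`lintegral_exp_card_reach_le`). Blocks of boxes at well-separated scales
use disjoint sets of edges, so Borel–Cantelli makes some block succeed (`ae_edist_le_of_exp_le`). -/

namespace ScaleFreePercolation
open scoped ENNReal

/-! ### Independence for functions of disjoint blocks of coordinates. -/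

section Independence

variable {ι α : Type*}

/-- Extend a partial configuration on `F` by a constant value. -/
noncomputable def extendBy (a : α) (F : Finset ι) (g : F → α) : ι → α :=
  open Classical in fun i => if h : i ∈ F then g ⟨i, h⟩ else a

theorem _root_.DependsOn.extendBy_eq {β : Type*} {F : Finset ι} {Y : (ι → α) → β}
    (h : DependsOn Y F) (a : α) (ω : ι → α) : Y (extendBy a F fun i => ω i) = Y ω :=
  h fun i hi => by
    have hi' : i ∈ F := hi
    simp [extendBy, hi']

variable [MeasurableSpace α]

theorem measurable_extendBy (a : α) (F : Finset ι) : Measurable (extendBy a F) := by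
  refine measurable_pi_lambda _ fun i => ?_
  by_cases h : i ∈ F
  · simp only [extendBy, h, dif_pos]
    fun_prop
  · simp only [extendBy, h, dif_neg, not_false_eq_true]
    fun_prop

/-- The function factors through the finite discrete space `F → Bool`, on which every map is
measurable. -/
theorem measurable_of_dependsOn {β : Type*} [MeasurableSpace β] {F : Finset ι}
    {Y : (ι → Bool) → β} (h : DependsOn Y F) : Measurable Y := by
  have h1 : Y = (fun g => Y (extendBy true F g)) ∘ fun ω (i : F) => ω i := by
    funext ω
    exact (h.extendBy_eq true ω).symm
  rw [h1]
  exact Measurable.of_discrete.comp (by fun_prop)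

theorem measurableSet_of_dependsOn {F : Finset ι} {E : Set (ι → Bool)}
    (h : DependsOn (· ∈ E) (F : Set ι)) : MeasurableSet E :=
  measurableSet_setOfPred.2 (measurable_of_dependsOn h)

theorem iIndepFun_of_dependsOn [Nonempty α] {κ : Type*} {β : κ → Type*}
    [∀ k, MeasurableSpace (β k)] (P : ι → Measure α) [∀ i, IsProbabilityMeasure (P i)]
    {F : κ → Finset ι} (hF : Pairwise fun k l => Disjoint (F k) (F l))
    {Y : ∀ k, (ι → α) → β k} (hY : ∀ k, Measurable (Y k))
    (hdep : ∀ k, DependsOn (Y k) (F k : Set ι)) : iIndepFun Y (Measure.infinitePi P) := by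
  obtain ⟨a⟩ := ‹Nonempty α›
  have h : iIndepFun (fun k ω (i : F k) => ω i) (Measure.infinitePi P) := by
    have hinj : Function.Injective fun q : (k : κ) × F k => (q.2 : ι) := by
      rintro ⟨k, i, hi⟩ ⟨l, j, hj⟩ hij
      obtain rfl : i = j := hij
      obtain rfl : k = l := by
        by_contra hkl
        exact Finset.disjoint_left.1 (hF hkl) hi hj
      rfl
    have e1 := Measure.map_infinitePi_infinitePi_of_inj (P := P) hinj
    have e2 := Measure.infinitePi_map_piCurry fun k (i : F k) => P i
    rw [iIndepFun_iff_map_fun_eq_infinitePi_map (by fun_prop)]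
    have e3 : ∀ k, (Measure.infinitePi P).map (fun ω (i : F k) => ω i) =
        Measure.infinitePi fun i : F k => P i := fun k =>
      Measure.map_infinitePi_infinitePi_of_inj (P := P) Subtype.val_injective
    simp_rw [e3]
    rw [← e2, ← e1, Measure.map_map (by fun_prop) (by fun_prop)]
    rfl
  have h2 := h.comp (fun k g => Y k (extendBy a (F k) g))
    (fun k => (hY k).comp (measurable_extendBy a (F k)))
  convert! h2 using 2 with k
  funext ω
  exact ((hdep k).extendBy_eq a ω).symm

/-- The form of the second Borel–Cantelli lemma used throughout, for weights as well as for edges: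
disjoint supports supply the independence, and a uniform lower bound on the probabilities makes
their sum diverge. -/
theorem frequently_mem_of_dependsOn [Nonempty α] (P : ι → Measure α)
    [∀ i, IsProbabilityMeasure (P i)] {F : ℕ → Finset ι}
    (hF : Pairwise fun k l => Disjoint (F k) (F l)) {E : ℕ → Set (ι → α)}
    (hE : ∀ n, MeasurableSet (E n)) (hdep : ∀ n, DependsOn (· ∈ E n) (F n : Set ι))
    {δ : ℝ≥0∞} (hδ : δ ≠ 0) (hP : ∀ᶠ n in Filter.atTop, δ ≤ Measure.infinitePi P (E n)) :
    ∀ᵐ ω ∂Measure.infinitePi P, ∃ᶠ n in Filter.atTop, ω ∈ E n := by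
  have hind : iIndepSet E (Measure.infinitePi P) := by
    have h := iIndepFun_of_dependsOn P hF (Y := fun n ω => ω ∈ E n)
      (fun n => measurable_mem.2 (hE n)) hdep
    rw [iIndepSet_iff_meas_biInter hE]
    intro s
    have := h.measure_inter_preimage_eq_mul s (sets := fun _ => {True}) (fun i _ => trivial)
    simpa [Set.preimage] using this
  have hsum : ∑' n, Measure.infinitePi P (E n) = ∞ := by
    by_contra h
    have h0 := ENNReal.tendsto_atTop_zero_of_tsum_ne_top h
    exact hδ (le_antisymm (ge_of_tendsto h0 hP) zero_le)
  have h1 := measure_limsup_eq_one hE hind hsum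
  have h2 := (prob_compl_eq_zero_iff (MeasurableSet.measurableSet_limsup hE)).2 h1
  filter_upwards [measure_eq_zero_iff_ae_notMem.1 h2] with ω hω
  rw [Set.notMem_compl_iff, Filter.mem_limsup_iff_frequently_mem] at hω
  exact hω

/-- Decoupling: the coordinates in `S` and in `T` are independent, so those in `T` may be resampled
from a fresh copy. This replaces conditioning on the part of the graph already explored. -/
theorem lintegral_diag_of_dependsOn (P : ι → Measure Bool) [∀ i, IsProbabilityMeasure (P i)]
    {S T : Finset ι} (hST : Disjoint S T) {G : (ι → Bool) → (ι → Bool) → ℝ≥0∞}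
    (hS : ∀ η', DependsOn (fun η => G η η') (S : Set ι))
    (hT : ∀ η, DependsOn (G η) (T : Set ι)) :
    ∫⁻ η, G η η ∂Measure.infinitePi P =
      ∫⁻ η, ∫⁻ η', G η η' ∂Measure.infinitePi P ∂Measure.infinitePi P := by
  have hm : ∀ {F : Finset ι}, Measurable fun (ω : ι → Bool) (i : F) => ω i := by
    intro F
    fun_prop
  have hind := (iIndepFun_infinitePi (P := P) (X := fun _ x => x)
    fun _ => measurable_id).indepFun_finset S T hST (fun i => by fun_prop)
  have hmap := (indepFun_iff_map_prod_eq_prod_map_map hm.aemeasurable hm.aemeasurable).1 hind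
  set g : (S → Bool) × (T → Bool) → ℝ≥0∞ := fun q =>
    G (extendBy true S q.1) (extendBy true T q.2) with hg
  have hGg : ∀ η η' : ι → Bool, G η η' = g (fun i => η i, fun i => η' i) := by
    intro η η'
    simp only [hg]
    rw [(hT _).extendBy_eq true η', (hS η').extendBy_eq true η]
  have hgm : Measurable g := Measurable.of_discrete
  calc ∫⁻ η, G η η ∂Measure.infinitePi P
      = ∫⁻ q, g q ∂((Measure.infinitePi P).map
          fun η => ((fun i : S => η i), fun i : T => η i)) := by
        rw [lintegral_map hgm (by fun_prop)]
        simp_rw [hGg]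
    _ = _ := by
        have := Measure.isProbabilityMeasure_map (μ := Measure.infinitePi P)
          (f := fun η (i : T) => η i) hm.aemeasurable
        rw [hmap, lintegral_prod _ hgm.aemeasurable, lintegral_map Measurable.of_discrete (by fun_prop)]
        simp_rw [hGg]
        congr 1
        funext η
        rw [lintegral_map Measurable.of_discrete (by fun_prop)]

end Independence

/-! ### One step of exploration with independent edges. -/

section Bernoulli

variable {V : Type*}

/-- The law of independent edges, where `e` is open with probability `p e`. -/
noncomputable abbrev edgeLaw (p : Sym2 V → unitInterval) : Measure (Sym2 V → Bool) :=
  Measure.infinitePi fun e => bernoulliMeasure true false (p e)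

theorem edgeLaw_open (p : Sym2 V → unitInterval) (F : Finset (Sym2 V)) :
    edgeLaw p {η | ∀ e ∈ F, η e = true} = ∏ e ∈ F, ENNReal.ofReal (p e) := by
  have h := Measure.infinitePi_pi (fun e => bernoulliMeasure true false (p e)) (s := F)
    (t := fun _ => {true}) fun _ _ => by measurability
  have h2 : {η : Sym2 V → Bool | ∀ e ∈ F, η e = true} = (F : Set (Sym2 V)).pi fun _ => {true} := by
    ext; simp [Set.mem_pi]
  rw [h2, h]
  refine Finset.prod_congr rfl fun e _ => ?_
  rw [← ofReal_measureReal, bernoulliMeasure_real_apply_of_mem_of_notMem] <;> simp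

theorem edgeLaw_closed (p : Sym2 V → unitInterval) (F : Finset (Sym2 V)) :
    edgeLaw p {η | ∀ e ∈ F, η e = false} = ∏ e ∈ F, ENNReal.ofReal (1 - p e) := by
  have h := Measure.infinitePi_pi (fun e => bernoulliMeasure true false (p e)) (s := F)
    (t := fun _ => {false}) fun _ _ => by measurability
  have h2 : {η : Sym2 V → Bool | ∀ e ∈ F, η e = false} =
      (F : Set (Sym2 V)).pi fun _ => {false} := by
    ext; simp [Set.mem_pi]
  rw [h2, h]
  refine Finset.prod_congr rfl fun e _ => ?_
  rw [← ofReal_measureReal, bernoulliMeasure_real_apply_of_notMem_of_mem] <;> simp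

theorem edgeLaw_closed_le {p : Sym2 V → unitInterval} {F : Finset (Sym2 V)} {t : ℝ}
    (h : ∀ e ∈ F, 1 - (p e : ℝ) ≤ Real.exp (-t)) :
    edgeLaw p {η | ∀ e ∈ F, η e = false} ≤ ENNReal.ofReal (Real.exp (-(t * F.card))) := by
  rw [edgeLaw_closed]
  calc ∏ e ∈ F, ENNReal.ofReal (1 - p e) ≤ ∏ _e ∈ F, ENNReal.ofReal (Real.exp (-t)) :=
        Finset.prod_le_prod' fun e he => ENNReal.ofReal_le_ofReal (h e he)
    _ = ENNReal.ofReal (Real.exp (-(t * F.card))) := by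
        rw [Finset.prod_const, ← ENNReal.ofReal_pow (Real.exp_nonneg _), ← Real.exp_nat_mul]
        congr 2
        ring

open Classical in
/-- All edges between `s` and `t`. -/
noncomputable def edgesBetween (s t : Finset V) : Finset (Sym2 V) :=
  (s ×ˢ t).image fun q => s(q.1, q.2)

theorem mem_edgesBetween {s t : Finset V} {e : Sym2 V} :
    e ∈ edgesBetween s t ↔ ∃ a ∈ s, ∃ b ∈ t, s(a, b) = e := by
  simp [edgesBetween, and_assoc]

open Classical in
/-- The vertices of `A` joined to `s` by an open edge. -/
noncomputable def nbrs (A : Finset V) (η : Sym2 V → Bool) (s : Finset V) : Finset V :=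
  A.filter fun z => ∃ a ∈ s, η s(a, z) = true

theorem mem_nbrs {A s : Finset V} {η : Sym2 V → Bool} {z : V} :
    z ∈ nbrs A η s ↔ z ∈ A ∧ ∃ a ∈ s, η s(a, z) = true := by
  simp [nbrs]

theorem dependsOn_nbrs {A B s : Finset V} (hs : s ⊆ B) :
    DependsOn (fun η => nbrs A η s) (edgesBetween B A : Set (Sym2 V)) := by
  intro η η' h
  ext z
  simp only [mem_nbrs]
  refine and_congr_right fun hz => exists_congr fun a => and_congr_right fun ha => ?_
  rw [h _ (mem_edgesBetween.2 ⟨a, hs ha, z, hz, rfl⟩)]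

theorem edgeLaw_notAdj_le {p : Sym2 V → unitInterval} {s : Finset V} {z : V} {t : ℝ}
    (h : ∀ a ∈ s, 1 - (p s(a, z) : ℝ) ≤ Real.exp (-t)) :
    edgeLaw p {η | ¬ ∃ a ∈ s, η s(a, z) = true} ≤ ENNReal.ofReal (Real.exp (-(t * s.card))) := by
  classical
  have hinj : Function.Injective fun a : V => s(a, z) := fun a b hab => by
    rcases Sym2.eq_iff.1 hab with ⟨h, -⟩ | ⟨h1, h2⟩
    exacts [h, h1.trans h2]
  have h1 := edgeLaw_closed_le (p := p) (F := s.image fun a => s(a, z)) (t := t) (by simpa using h)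
  rw [Finset.card_image_of_injective _ hinj] at h1
  refine le_trans (le_of_eq ?_) h1
  congr 1
  ext η
  simp

/-- The vertices of `A` are joined to `s` independently of one another, because `s` and `A` are
disjoint and so no edge is shared. The Laplace transform is thus a product, and each factor is at
most `1 - (1 - e⁻ᵘ)(1 - q)`, where `q` bounds the probability of not being joined. -/
theorem lintegral_exp_card_nbrs_le {p : Sym2 V → unitInterval} {s A : Finset V} {t u : ℝ}
    (hd : Disjoint s A) (hu : 0 ≤ u)
    (h : ∀ a ∈ s, ∀ z ∈ A, 1 - (p s(a, z) : ℝ) ≤ Real.exp (-t)) :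
    ∫⁻ η, ENNReal.ofReal (Real.exp (-(u * (nbrs A η s).card))) ∂edgeLaw p ≤
      ENNReal.ofReal
        (Real.exp (-(A.card * ((1 - Real.exp (-u)) * (1 - Real.exp (-(t * s.card))))))) := by
  classical
  set q := Real.exp (-(t * s.card)) with hq
  set X : A → (Sym2 V → Bool) → ℝ≥0∞ := fun z η =>
    ENNReal.ofReal (Real.exp (-(if ∃ a ∈ s, η s(a, z.1) = true then u else 0))) with hX
  have hdep : ∀ z : A, DependsOn (X z) (edgesBetween s {z.1} : Set (Sym2 V)) := by
    intro z η η' h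
    have : (∃ a ∈ s, η s(a, z.1) = true) ↔ ∃ a ∈ s, η' s(a, z.1) = true := by
      refine exists_congr fun a => and_congr_right fun ha => ?_
      rw [h _ (mem_edgesBetween.2 ⟨a, ha, z.1, by simp, rfl⟩)]
    simp only [hX, this]
  have hmeas : ∀ z, Measurable (X z) := fun z => measurable_of_dependsOn (hdep z)
  have hind : iIndepFun X (edgeLaw p) := by
    refine iIndepFun_of_dependsOn _ (F := fun z : A => edgesBetween s {z.1}) ?_ hmeas hdep
    intro z z' hzz
    rw [Finset.disjoint_left]
    rintro _ he he'
    obtain ⟨a, ha, b, hb, rfl⟩ := mem_edgesBetween.1 he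
    obtain ⟨a', ha', b', hb', hab⟩ := mem_edgesBetween.1 he'
    rw [Finset.mem_singleton] at hb hb'
    subst hb hb'
    rcases Sym2.eq_iff.1 hab with ⟨-, h2⟩ | ⟨h1, -⟩
    · exact hzz (Subtype.ext h2.symm)
    · exact Finset.disjoint_left.1 hd ha' (h1 ▸ z.2)
  have hprod : ∀ η, ENNReal.ofReal (Real.exp (-(u * (nbrs A η s).card))) =
      ∏ z ∈ (Finset.univ : Finset A), X z η := by
    intro η
    simp only [hX]
    rw [← ENNReal.ofReal_prod_of_nonneg fun _ _ => Real.exp_nonneg _, ← Real.exp_sum,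
      Finset.sum_neg_distrib, Finset.sum_coe_sort A
        (fun z => if ∃ a ∈ s, η s(a, z) = true then u else 0), ← Finset.sum_filter,
      Finset.sum_const, nsmul_eq_mul, mul_comm u]
    rfl
  have hsingle : ∀ z, ∫⁻ η, X z η ∂edgeLaw p ≤
      ENNReal.ofReal (Real.exp (-((1 - Real.exp (-u)) * (1 - q)))) := by
    intro z
    set D : Set (Sym2 V → Bool) := {η | ¬ ∃ a ∈ s, η s(a, z.1) = true} with hD
    have hXD : ∀ η, X z η = ENNReal.ofReal (Real.exp (-u)) +
        D.indicator (fun _ => ENNReal.ofReal (1 - Real.exp (-u))) η := by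
      intro η
      have hu1 : Real.exp (-u) ≤ 1 := Real.exp_le_one_iff.2 (by linarith)
      by_cases hη : ∃ a ∈ s, η s(a, z.1) = true
      · have : η ∉ D := fun h => h hη
        simp only [hX, if_pos hη, Set.indicator_of_notMem this, add_zero]
      · have : η ∈ D := hη
        simp only [hX, if_neg hη, Set.indicator_of_mem this]
        rw [← ENNReal.ofReal_add (Real.exp_nonneg _) (by linarith)]
        simp
    have hDm : MeasurableSet D := by
      refine measurableSet_of_dependsOn (F := edgesBetween s {z.1}) ?_
      intro η η' h
      have : (∃ a ∈ s, η s(a, z.1) = true) ↔ ∃ a ∈ s, η' s(a, z.1) = true := by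
        refine exists_congr fun a => and_congr_right fun ha => ?_
        rw [h _ (mem_edgesBetween.2 ⟨a, ha, z.1, by simp, rfl⟩)]
      simp only [hD, Set.mem_ofPred_eq, this]
    have hu1 : Real.exp (-u) ≤ 1 := Real.exp_le_one_iff.2 (by linarith)
    have hDq : edgeLaw p D ≤ ENNReal.ofReal q := edgeLaw_notAdj_le fun a ha => h a ha z z.2
    simp_rw [hXD]
    rw [lintegral_add_left measurable_const, lintegral_const, measure_univ, mul_one,
      lintegral_indicator_const hDm]
    calc _ ≤ ENNReal.ofReal (Real.exp (-u)) +
          ENNReal.ofReal (1 - Real.exp (-u)) * ENNReal.ofReal q := by gcongr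
      _ = ENNReal.ofReal (Real.exp (-u) + (1 - Real.exp (-u)) * q) := by
          rw [← ENNReal.ofReal_mul (by linarith), ← ENNReal.ofReal_add (Real.exp_nonneg _)]
          exact mul_nonneg (by linarith) (Real.exp_nonneg _)
      _ ≤ _ := by
          apply ENNReal.ofReal_le_ofReal
          have := Real.add_one_le_exp (-((1 - Real.exp (-u)) * (1 - q)))
          linarith
  simp_rw [hprod]
  rw [lintegral_prod_eq_prod_lintegral_of_indepFun _ X hind hmeas]
  calc _ ≤ ∏ _z ∈ (Finset.univ : Finset A),
        ENNReal.ofReal (Real.exp (-((1 - Real.exp (-u)) * (1 - q)))) :=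
      Finset.prod_le_prod' fun z _ => hsingle z
    _ = _ := by
      rw [Finset.prod_const, ← ENNReal.ofReal_pow (Real.exp_nonneg _), ← Real.exp_nat_mul,
        Finset.card_univ, Fintype.card_coe]
      congr 2
      ring

theorem min_one_half_le_one_sub_exp_neg {x : ℝ} (hx : 0 ≤ x) :
    min x 1 / 2 ≤ 1 - Real.exp (-x) := by
  wlog h : x ≤ 1 generalizing x
  · have h1 := this zero_le_one le_rfl
    rw [min_eq_right (not_le.1 h).le]
    have : Real.exp (-x) ≤ Real.exp (-1) := Real.exp_le_exp.2 (by linarith [not_le.1 h])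
    simp only [min_self] at h1
    linarith
  rw [min_eq_left h]
  have h1 : Real.exp (-x) ≤ 1 / (1 + x) := by
    rw [Real.exp_neg, one_div]
    exact inv_anti₀ (by linarith) (by linarith [Real.add_one_le_exp x])
  have h2 : 1 / (1 + x) ≤ 1 - x / 2 := by
    rw [div_le_iff₀ (by linarith)]
    nlinarith
  linarith

/-- Both factors `1 - e⁻ˣ` are bounded below by `min x 1 / 2`, whence the `4`. The two summands
correspond to `t * s.card ≤ 1`, where the number of neighbours is proportional to `s.card`, and to
the saturated case, where a positive fraction of `A` is reached. -/
theorem lintegral_exp_card_nbrs_le_add {p : Sym2 V → unitInterval} {s A : Finset V} {N t u : ℝ}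
    (hd : Disjoint s A) (hu : 0 ≤ u) (hu1 : u ≤ 1) (ht : 0 ≤ t) (hN : 0 ≤ N) (hNA : N ≤ A.card)
    (h : ∀ a ∈ s, ∀ z ∈ A, 1 - (p s(a, z) : ℝ) ≤ Real.exp (-t)) :
    ∫⁻ η, ENNReal.ofReal (Real.exp (-(u * (nbrs A η s).card))) ∂edgeLaw p ≤
      ENNReal.ofReal (Real.exp (-(N * u * t / 4 * s.card))) +
        ENNReal.ofReal (Real.exp (-(N * u / 4))) := by
  refine (lintegral_exp_card_nbrs_le hd hu h).trans ?_
  rw [← ENNReal.ofReal_add (Real.exp_nonneg _) (Real.exp_nonneg _)]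
  apply ENNReal.ofReal_le_ofReal
  have hs : 0 ≤ t * s.card := by positivity
  have h1 := min_one_half_le_one_sub_exp_neg hu
  have h2 := min_one_half_le_one_sub_exp_neg hs
  rw [min_eq_left hu1] at h1
  have h3 : N * ((u / 2) * (min (t * s.card) 1 / 2)) ≤
      A.card * ((1 - Real.exp (-u)) * (1 - Real.exp (-(t * s.card)))) := by
    have : 0 ≤ min (t * s.card) 1 / 2 := by positivity
    gcongr
    linarith
  refine (Real.exp_le_exp.2 (neg_le_neg h3)).trans ?_
  rcases le_total (t * s.card) 1 with h4 | h4
  · rw [min_eq_left h4, show N * (u / 2 * (t * s.card / 2)) = N * u * t / 4 * s.card by ring]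
    linarith [Real.exp_nonneg (-(N * u / 4))]
  · rw [min_eq_right h4, show N * (u / 2 * (1 / 2)) = N * u / 4 by ring]
    linarith [Real.exp_nonneg (-(N * u * t / 4 * s.card))]

end Bernoulli

/-! ### Exploration through successive layers. -/

section Layers

variable {V : Type*}

/-- The vertices of the `j`-th layer that can be reached from the `0`-th layer by an open path
that visits the layers one after the other. -/
noncomputable def reach (A : ℕ → Finset V) (η : Sym2 V → Bool) : ℕ → Finset V
  | 0 => A 0
  | j + 1 => nbrs (A (j + 1)) η (reach A η j)

theorem reach_subset (A : ℕ → Finset V) (η : Sym2 V → Bool) (j : ℕ) : reach A η j ⊆ A j := by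
  cases j with
  | zero => exact subset_rfl
  | succ j => exact fun z hz => (mem_nbrs.1 hz).1

open Classical in
/-- The edges between consecutive layers, up to layer `j`. -/
noncomputable def layerEdges (A : ℕ → Finset V) (j : ℕ) : Finset (Sym2 V) :=
  (Finset.range j).biUnion fun i => edgesBetween (A i) (A (i + 1))

theorem mem_layerEdges {A : ℕ → Finset V} {j : ℕ} {e : Sym2 V} :
    e ∈ layerEdges A j ↔ ∃ i < j, ∃ a ∈ A i, ∃ b ∈ A (i + 1), s(a, b) = e := by
  simp [layerEdges, mem_edgesBetween]

theorem dependsOn_reach (A : ℕ → Finset V) (j : ℕ) :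
    DependsOn (fun η => reach A η j) (layerEdges A j : Set (Sym2 V)) := by
  induction j with
  | zero => exact fun _ _ _ => rfl
  | succ j ih =>
    intro η η' h
    have h1 : reach A η j = reach A η' j := ih fun e he => h e <| by
      obtain ⟨i, hi, h⟩ := mem_layerEdges.1 he
      exact mem_layerEdges.2 ⟨i, hi.trans j.lt_succ_self, h⟩
    simp only [reach, h1]
    refine dependsOn_nbrs (reach_subset A η' j) fun e he => h e ?_
    exact mem_layerEdges.2 ⟨j, j.lt_succ_self, mem_edgesBetween.1 he⟩

/-- Since the layers are disjoint, an edge determines the layers of its endpoints. Hence the next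
step of the exploration uses fresh edges. -/
theorem disjoint_layerEdges {A : ℕ → Finset V} (hA : Pairwise fun i j => Disjoint (A i) (A j))
    (j : ℕ) : Disjoint (layerEdges A j) (edgesBetween (A j) (A (j + 1))) := by
  have key : ∀ {i j a}, a ∈ A i → a ∈ A j → i = j := fun {i j a} hi hj => by
    by_contra hij
    exact Finset.disjoint_left.1 (hA hij) hi hj
  rw [Finset.disjoint_left]
  intro e he he'
  obtain ⟨i, hi, a, ha, b, hb, rfl⟩ := mem_layerEdges.1 he
  obtain ⟨a', ha', b', hb', hab⟩ := mem_edgesBetween.1 he'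
  rcases Sym2.eq_iff.1 hab with ⟨rfl, rfl⟩ | ⟨rfl, rfl⟩
  · exact hi.ne (key ha ha')
  · have := key ha hb'
    omega

theorem lintegral_exp_card_reach_succ_le {A : ℕ → Finset V} {p : Sym2 V → unitInterval}
    {N t u : ℝ} {j : ℕ} (hA : Pairwise fun i j => Disjoint (A i) (A j))
    (hu : 0 ≤ u) (hu1 : u ≤ 1) (ht : 0 ≤ t) (hN : 0 ≤ N) (hNA : N ≤ (A (j + 1)).card)
    (h : ∀ a ∈ A j, ∀ z ∈ A (j + 1), 1 - (p s(a, z) : ℝ) ≤ Real.exp (-t)) :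
    ∫⁻ η, ENNReal.ofReal (Real.exp (-(u * (reach A η (j + 1)).card))) ∂edgeLaw p ≤
      ∫⁻ η, ENNReal.ofReal (Real.exp (-(N * u * t / 4 * (reach A η j).card))) ∂edgeLaw p +
        ENNReal.ofReal (Real.exp (-(N * u / 4))) := by
  have h1 := lintegral_diag_of_dependsOn (fun e => bernoulliMeasure true false (p e))
    (disjoint_layerEdges hA j)
    (G := fun η η' => ENNReal.ofReal
      (Real.exp (-(u * (nbrs (A (j + 1)) η' (reach A η j)).card))))
    (fun η' η₁ η₂ h => by
      have : reach A η₁ j = reach A η₂ j := dependsOn_reach A j h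
      simp only [this])
    (fun η η₁ η₂ h => by
      have : nbrs (A (j + 1)) η₁ (reach A η j) = nbrs (A (j + 1)) η₂ (reach A η j) :=
        dependsOn_nbrs (reach_subset A η j) h
      simp only [this])
  simp only [reach]
  rw [h1]
  calc _ ≤ ∫⁻ η, (ENNReal.ofReal (Real.exp (-(N * u * t / 4 * (reach A η j).card))) +
        ENNReal.ofReal (Real.exp (-(N * u / 4)))) ∂edgeLaw p :=
      lintegral_mono fun η => lintegral_exp_card_nbrs_le_add
        ((hA (by omega : j ≠ j + 1)).mono_left (reach_subset A η j)) hu hu1 ht hN hNA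
        fun a ha z hz => h a (reach_subset A η j ha) z hz
    _ = _ := by
      rw [lintegral_add_right _ measurable_const, lintegral_const, measure_univ, mul_one]

/-- Going back one layer multiplies the Laplace parameter by `a = N * t / 4` and costs an error of
at most `exp (-a)`. Starting from `t` at layer `m`, the parameter is `a ^ m * t` at layer `0`, which
is a single vertex. -/
theorem lintegral_exp_card_reach_le {A : ℕ → Finset V} {p : Sym2 V → unitInterval}
    {N t : ℝ} {m : ℕ} (hA : Pairwise fun i j => Disjoint (A i) (A j)) (hA0 : (A 0).card = 1)
    (ht : 0 ≤ t) (hN : 0 ≤ N) (hNA : ∀ j, 1 ≤ j → j ≤ m → N ≤ (A j).card)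
    (h : ∀ j < m, ∀ a ∈ A j, ∀ z ∈ A (j + 1), 1 - (p s(a, z) : ℝ) ≤ Real.exp (-t))
    (ha : 1 ≤ N * t / 4) (hat : (N * t / 4) ^ (m - 1) * t ≤ 1) :
    ∫⁻ η, ENNReal.ofReal (Real.exp (-(t * (reach A η m).card))) ∂edgeLaw p ≤
      ENNReal.ofReal (Real.exp (-((N * t / 4) ^ m * t))) +
        m * ENNReal.ofReal (Real.exp (-(N * t / 4))) := by
  set a := N * t / 4 with ha'
  have key : ∀ j i, i + j = m →
      ∫⁻ η, ENNReal.ofReal (Real.exp (-(a ^ i * t * (reach A η j).card))) ∂edgeLaw p ≤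
      ENNReal.ofReal (Real.exp (-(a ^ m * t))) + j * ENNReal.ofReal (Real.exp (-a)) := by
    intro j
    induction j with
    | zero =>
      rintro i rfl
      simp [reach, hA0]
    | succ j ih =>
      intro i hij
      -- The one-step bound needs a parameter at most `1`. Here `i ≤ m - 1`, so `hat` covers every
      -- step because `1 ≤ a`.
      have hi : a ^ i * t ≤ 1 := by
        refine le_trans ?_ hat
        gcongr
        omega
      refine (lintegral_exp_card_reach_succ_le hA (by positivity) hi ht hN
        (hNA _ (by omega) (by omega)) (h j (by omega))).trans ?_
      have h1 : N * (a ^ i * t) * t / 4 = a ^ (i + 1) * t := by rw [pow_succ, ha']; ring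
      have h2 : N * (a ^ i * t) / 4 = a ^ (i + 1) := by rw [pow_succ, ha']; ring
      have h3 : a ≤ a ^ (i + 1) := le_self_pow₀ ha (by omega)
      rw [h1, h2, Nat.cast_succ, add_mul, one_mul, ← add_assoc]
      refine add_le_add (ih (i + 1) (by omega)) ?_
      gcongr
  simpa using key m 0 (by simp)

/-- The edges into `y` are not used in the exploration, so given the reached set the last hop fails
with probability at most `exp (-t * card)`. This is why the Laplace transform at `t` is the quantity
to bound. -/
theorem edgeLaw_not_exists_reach_le {A : ℕ → Finset V} {p : Sym2 V → unitInterval} {y : V}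
    {t : ℝ} {m : ℕ} (hy : ∀ j ≤ m, y ∉ A j)
    (h : ∀ a ∈ A m, 1 - (p s(a, y) : ℝ) ≤ Real.exp (-t)) :
    edgeLaw p {η | ¬ ∃ a ∈ reach A η m, η s(a, y) = true} ≤
      ∫⁻ η, ENNReal.ofReal (Real.exp (-(t * (reach A η m).card))) ∂edgeLaw p := by
  classical
  have hdis : Disjoint (layerEdges A m) (edgesBetween (A m) {y}) := by
    rw [Finset.disjoint_left]
    intro e he he'
    obtain ⟨i, hi, a, ha, b, hb, rfl⟩ := mem_layerEdges.1 he
    obtain ⟨a', ha', b', hb', hab⟩ := mem_edgesBetween.1 he'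
    rw [Finset.mem_singleton] at hb'
    subst hb'
    rcases Sym2.eq_iff.1 hab with ⟨-, rfl⟩ | ⟨-, rfl⟩
    · exact hy _ (by omega) hb
    · exact hy _ hi.le ha
  have hmem : ∀ {B : Finset V} {η₁ η₂ : Sym2 V → Bool}, B ⊆ A m →
      (∀ e ∈ (edgesBetween (A m) {y} : Set (Sym2 V)), η₁ e = η₂ e) →
      ((∃ a ∈ B, η₁ s(a, y) = true) ↔ ∃ a ∈ B, η₂ s(a, y) = true) := by
    intro B η₁ η₂ hB h
    refine exists_congr fun a => and_congr_right fun ha => ?_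
    rw [h _ (mem_edgesBetween.2 ⟨a, hB ha, y, by simp, rfl⟩)]
  have h1 := lintegral_diag_of_dependsOn (fun e => bernoulliMeasure true false (p e)) hdis
    (G := fun η η' => if ∃ a ∈ reach A η m, η' s(a, y) = true then 0 else 1)
    (fun η' η₁ η₂ h => by
      have : reach A η₁ m = reach A η₂ m := dependsOn_reach A m h
      simp only [this])
    (fun η η₁ η₂ h => by simp only [hmem (reach_subset A η m) h])
  have hmeas : MeasurableSet {η : Sym2 V → Bool | ¬ ∃ a ∈ reach A η m, η s(a, y) = true} := by
    refine measurableSet_of_dependsOn (F := layerEdges A m ∪ edgesBetween (A m) {y}) ?_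
    intro η₁ η₂ h
    have : reach A η₁ m = reach A η₂ m :=
      dependsOn_reach A m fun e he => h e (Finset.mem_union_left _ he)
    simp only [Set.mem_ofPred_eq, this,
      hmem (reach_subset A η₂ m) fun e he => h e (Finset.mem_union_right _ he)]
  have h2 : ∀ B : Finset V, B ⊆ A m →
      ∫⁻ η', (if ∃ a ∈ B, η' s(a, y) = true then (0 : ℝ≥0∞) else 1) ∂edgeLaw p ≤
        ENNReal.ofReal (Real.exp (-(t * B.card))) := by
    intro B hB
    refine le_trans (le_of_eq ?_) (edgeLaw_notAdj_le (p := p) fun a ha => h a (hB ha))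
    have hm : MeasurableSet {η : Sym2 V → Bool | ¬ ∃ a ∈ B, η s(a, y) = true} :=
      measurableSet_of_dependsOn (F := edgesBetween (A m) {y}) fun η₁ η₂ h => by
        simp only [Set.mem_ofPred_eq, hmem hB h]
    rw [← lintegral_indicator_one hm]
    congr 1
    funext η
    by_cases hη : ∃ a ∈ B, η s(a, y) = true <;> simp [Set.indicator, hη]
  calc _ = ∫⁻ η, (if ∃ a ∈ reach A η m, η s(a, y) = true then (0 : ℝ≥0∞) else 1) ∂edgeLaw p := by
        rw [← lintegral_indicator_one hmeas]
        congr 1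
        funext η
        by_cases hη : ∃ a ∈ reach A η m, η s(a, y) = true <;> simp [Set.indicator, hη]
    _ ≤ _ := by
        rw [h1]
        exact lintegral_mono fun η => h2 _ (reach_subset A η m)

end Layers

/-! ### Dyadic boxes in the lattice and paths through them. -/

section Lattice

variable {d : ℕ}

theorem openGraph_adj {η : Sym2 (Fin d → ℤ) → Bool} {a b : Fin d → ℤ} :
    (openGraph η).Adj a b ↔ η s(a, b) = true ∧ a ≠ b := by
  simp [openGraph]

theorem edist_le_of_mem_reach {A : ℕ → Finset (Fin d → ℤ)} {x : Fin d → ℤ}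
    (hA : Pairwise fun i j => Disjoint (A i) (A j)) (hA0 : A 0 = {x})
    (η : Sym2 (Fin d → ℤ) → Bool) {j : ℕ} {z : Fin d → ℤ} (hz : z ∈ reach A η j) :
    (openGraph η).edist x z ≤ j := by
  induction j generalizing z with
  | zero =>
    simp only [reach, hA0, Finset.mem_singleton] at hz
    simp [hz]
  | succ j ih =>
    obtain ⟨hzA, a, ha, haz⟩ := mem_nbrs.1 hz
    have hne : a ≠ z := by
      rintro rfl
      exact Finset.disjoint_left.1 (hA (by omega : j ≠ j + 1)) (reach_subset A η j ha) hzA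
    have hadj : (openGraph η).Adj a z := openGraph_adj.2 ⟨haz, hne⟩
    calc _ ≤ (openGraph η).edist x a + (openGraph η).edist a z := SimpleGraph.edist_triangle
      _ ≤ j + 1 := add_le_add (ih ha) (SimpleGraph.edist_eq_one_iff_adj.2 hadj).le
      _ = _ := by push_cast; rfl

theorem one_le_l1Dist {a b : Fin d → ℤ} (h : a ≠ b) : 1 ≤ l1Dist a b := by
  obtain ⟨i, hi⟩ := Function.ne_iff.1 h
  have h1 : (1 : ℝ) ≤ |(a i : ℝ) - b i| := by
    exact_mod_cast Int.one_le_abs (sub_ne_zero.2 hi)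
  exact h1.trans (Finset.single_le_sum (f := fun i => |(a i : ℝ) - b i|)
    (fun _ _ => abs_nonneg _) (Finset.mem_univ i))

theorem l1Dist_le {a b : Fin d → ℤ} {m : ℕ} (ha : ∀ i, |a i| ≤ 2 ^ m) (hb : ∀ i, |b i| ≤ 2 ^ m) :
    l1Dist a b ≤ d * 2 ^ (m + 1) := by
  have h : ∀ i, |(a i : ℝ) - b i| ≤ 2 ^ (m + 1) := by
    intro i
    have h1 : |(a i : ℝ)| ≤ 2 ^ m := by exact_mod_cast ha i
    have h2 : |(b i : ℝ)| ≤ 2 ^ m := by exact_mod_cast hb i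
    calc _ ≤ |(a i : ℝ)| + |(b i : ℝ)| := abs_sub _ _
      _ ≤ 2 ^ (m + 1) := by rw [pow_succ]; linarith
  calc l1Dist a b ≤ ∑ _i : Fin d, (2 : ℝ) ^ (m + 1) := Finset.sum_le_sum fun i _ => h i
    _ = _ := by simp

/-- The cube `[2 ^ m, 2 ^ (m + 1)) ^ d`. -/
noncomputable def box (d m : ℕ) : Finset (Fin d → ℤ) :=
  Fintype.piFinset fun _ => Finset.Ico (2 ^ m) (2 ^ (m + 1))

theorem mem_box {m : ℕ} {z : Fin d → ℤ} : z ∈ box d m ↔ ∀ i, 2 ^ m ≤ z i ∧ z i < 2 ^ (m + 1) := by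
  simp [box]

theorem card_box (d m : ℕ) : (box d m).card = (2 ^ m) ^ d := by
  have : ((2 : ℤ) ^ (m + 1) - 2 ^ m).toNat = 2 ^ m := by
    rw [pow_succ, mul_two, add_sub_cancel_right]
    exact_mod_cast Int.toNat_natCast (2 ^ m)
  simp [box, this]

theorem abs_le_of_mem_box {m M : ℕ} {z : Fin d → ℤ} (hz : z ∈ box d m) (h : m < M) (i : Fin d) :
    |z i| ≤ 2 ^ M := by
  obtain ⟨h1, h2⟩ := mem_box.1 hz i
  have h3 : (0 : ℤ) ≤ 2 ^ m := by positivity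
  rw [abs_of_nonneg (h3.trans h1)]
  exact h2.le.trans (pow_le_pow_right₀ (by norm_num) h)

theorem notMem_box_of_abs_lt (hd : 1 ≤ d) {m M : ℕ} {z : Fin d → ℤ} (hz : ∀ i, |z i| < 2 ^ M)
    (h : M ≤ m) : z ∉ box d m := by
  intro hzm
  have h1 := (mem_box.1 hzm ⟨0, hd⟩).1
  have h2 := (abs_lt.1 (hz ⟨0, hd⟩)).2
  have h3 : (2 : ℤ) ^ M ≤ 2 ^ m := pow_le_pow_right₀ (by norm_num) h
  linarith

theorem eq_of_mem_box (hd : 1 ≤ d) {m m' : ℕ} {z : Fin d → ℤ} (h : z ∈ box d m)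
    (h' : z ∈ box d m') : m = m' := by
  wlog hlt : m < m' generalizing m m'
  · rcases (not_lt.1 hlt).eq_or_lt with h1 | h1
    · exact h1.symm
    · exact (this h' h h1).symm
  have h1 := (mem_box.1 h ⟨0, hd⟩).2
  have h2 := (mem_box.1 h' ⟨0, hd⟩).1
  have h3 : (2 : ℤ) ^ (m + 1) ≤ 2 ^ m' := pow_le_pow_right₀ (by norm_num) hlt
  linarith

theorem exists_abs_lt_two_pow (z : Fin d → ℤ) : ∃ M : ℕ, ∀ i, |z i| < 2 ^ M := by
  refine ⟨∑ i, (z i).natAbs, fun i => ?_⟩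
  have h1 : (z i).natAbs ≤ ∑ i, (z i).natAbs :=
    Finset.single_le_sum (f := fun i => (z i).natAbs) (fun _ _ => zero_le) (Finset.mem_univ i)
  have h2 : (z i).natAbs < 2 ^ ∑ i, (z i).natAbs := h1.trans_lt Nat.lt_two_pow_self
  rw [Int.abs_eq_natAbs]
  exact_mod_cast h2

/-- The layers `{x}, box (b + 1), box (b + 2), …`. -/
noncomputable def boxLayers (x : Fin d → ℤ) (b : ℕ) : ℕ → Finset (Fin d → ℤ)
  | 0 => {x}
  | j + 1 => box d (b + (j + 1))

theorem pairwise_disjoint_boxLayers (hd : 1 ≤ d) {x : Fin d → ℤ} {M b : ℕ}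
    (hx : ∀ i, |x i| < 2 ^ M) (hb : M ≤ b) :
    Pairwise fun i j => Disjoint (boxLayers x b i) (boxLayers x b j) := by
  intro i j hij
  rw [Finset.disjoint_left]
  intro z hi hj
  match i, j with
  | 0, 0 => exact hij rfl
  | 0, j + 1 =>
    obtain rfl := Finset.mem_singleton.1 hi
    exact notMem_box_of_abs_lt hd hx (by omega) hj
  | i + 1, 0 =>
    obtain rfl := Finset.mem_singleton.1 hj
    exact notMem_box_of_abs_lt hd hx (by omega) hi
  | i + 1, j + 1 =>
    have := eq_of_mem_box hd hi hj
    omega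

theorem abs_le_of_mem_boxLayers {x z : Fin d → ℤ} {M b j K : ℕ} (hx : ∀ i, |x i| < 2 ^ M)
    (hb : M ≤ b) (hz : z ∈ boxLayers x b j) (hj : j < K) (i : Fin d) : |z i| ≤ 2 ^ (b + K) := by
  match j with
  | 0 =>
    obtain rfl := Finset.mem_singleton.1 hz
    exact (hx i).le.trans (pow_le_pow_right₀ (by norm_num) (by omega))
  | j + 1 => exact abs_le_of_mem_box hz (by omega) i

open Classical in
/-- The edges that a path from `x` to `y` through the layers `1, …, m` of `boxLayers x b` may
use. -/
noncomputable def pathEdges (x y : Fin d → ℤ) (m b : ℕ) : Finset (Sym2 (Fin d → ℤ)) :=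
  layerEdges (boxLayers x b) m ∪ edgesBetween (boxLayers x b m) {y}

theorem exists_box_of_mem_boxLayers {x z : Fin d → ℤ} {b j m : ℕ} (hz : z ∈ boxLayers x b j)
    (hj : j ≤ m) : z = x ∨ ∃ i, 1 ≤ i ∧ i ≤ m ∧ z ∈ box d (b + i) := by
  match j with
  | 0 => exact Or.inl (Finset.mem_singleton.1 hz)
  | j + 1 => exact Or.inr ⟨j + 1, by omega, hj, hz⟩

theorem endpoints_of_mem_pathEdges {x y : Fin d → ℤ} {m b : ℕ} (hm : 1 ≤ m)
    {e : Sym2 (Fin d → ℤ)} (he : e ∈ pathEdges x y m b) :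
    (∃ v ∈ e, ∃ i, 1 ≤ i ∧ i ≤ m ∧ v ∈ box d (b + i)) ∧
      ∀ v ∈ e, v = x ∨ v = y ∨ ∃ i, 1 ≤ i ∧ i ≤ m ∧ v ∈ box d (b + i) := by
  classical
  rcases Finset.mem_union.1 he with he | he
  · obtain ⟨i, hi, a, ha, c, hc, rfl⟩ := mem_layerEdges.1 he
    refine ⟨⟨c, by simp, i + 1, by omega, hi, hc⟩, fun v hv => ?_⟩
    rcases Sym2.mem_iff.1 hv with rfl | rfl
    · rcases exists_box_of_mem_boxLayers ha hi.le with h | h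
      exacts [Or.inl h, Or.inr (Or.inr h)]
    · exact Or.inr (Or.inr ⟨i + 1, by omega, hi, hc⟩)
  · obtain ⟨a, ha, c, hc, rfl⟩ := mem_edgesBetween.1 he
    obtain ⟨m, rfl⟩ : ∃ l, m = l + 1 := ⟨m - 1, by omega⟩
    refine ⟨⟨a, by simp, m + 1, by omega, le_rfl, ha⟩, fun v hv => ?_⟩
    rcases Sym2.mem_iff.1 hv with rfl | rfl
    · exact Or.inr (Or.inr ⟨m + 1, by omega, le_rfl, ha⟩)
    · exact Or.inr (Or.inl (Finset.mem_singleton.1 hc))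

/-- Every path edge has an endpoint in one of its own boxes, and that endpoint is neither `x` nor
`y` nor in a box of another block. -/
theorem disjoint_pathEdges (hd : 1 ≤ d) {x y : Fin d → ℤ} {m M q q' : ℕ} (hm : 1 ≤ m)
    (hx : ∀ i, |x i| < 2 ^ M) (hy : ∀ i, |y i| < 2 ^ M) (hq : M ≤ (m + 1) * q) (hqq : q ≠ q') :
    Disjoint (pathEdges x y m ((m + 1) * q)) (pathEdges x y m ((m + 1) * q')) := by
  rw [Finset.disjoint_left]
  intro e he he'
  obtain ⟨v, hv, i, hi, him, hvi⟩ := (endpoints_of_mem_pathEdges hm he).1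
  rcases (endpoints_of_mem_pathEdges hm he').2 v hv with rfl | rfl | ⟨j, hj, hjm, hvj⟩
  · exact notMem_box_of_abs_lt hd hx (by omega) hvi
  · exact notMem_box_of_abs_lt hd hy (by omega) hvi
  · have h1 := eq_of_mem_box hd hvi hvj
    -- The box indices of a block are `(m + 1) * q + i` with `1 ≤ i ≤ m`, so the quotient by `m + 1`
    -- recovers `q`.
    have h2 := congrArg (· / (m + 1)) h1
    simp only [Nat.mul_add_div m.succ_pos, Nat.div_eq_of_lt (Nat.lt_succ_of_le him),
      Nat.div_eq_of_lt (Nat.lt_succ_of_le hjm)] at h2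
    exact hqq h2

/-- There is an open path from `x` to `y` through the layers `1, …, m` of `boxLayers x b`. -/
def pathEvent (x y : Fin d → ℤ) (m b : ℕ) : Set (Sym2 (Fin d → ℤ) → Bool) :=
  {η | ∃ a ∈ reach (boxLayers x b) η m, η s(a, y) = true}

theorem dependsOn_pathEvent (x y : Fin d → ℤ) (m b : ℕ) :
    DependsOn (· ∈ pathEvent x y m b) (pathEdges x y m b : Set (Sym2 (Fin d → ℤ))) := by
  classical
  intro η η' h
  have h1 : reach (boxLayers x b) η m = reach (boxLayers x b) η' m :=
    dependsOn_reach _ m fun e he => h e (Finset.mem_union_left _ he)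
  simp only [pathEvent, Set.mem_ofPred_eq, h1]
  refine propext <| exists_congr fun a => and_congr_right fun ha => ?_
  rw [h _ (Finset.mem_union_right _
    (mem_edgesBetween.2 ⟨a, reach_subset _ _ _ ha, y, by simp, rfl⟩))]

theorem edist_le_of_mem_pathEvent (hd : 1 ≤ d) {x y : Fin d → ℤ} {m M b : ℕ} (hm : 1 ≤ m)
    (hx : ∀ i, |x i| < 2 ^ M) (hy : ∀ i, |y i| < 2 ^ M) (hb : M ≤ b)
    {η : Sym2 (Fin d → ℤ) → Bool} (h : η ∈ pathEvent x y m b) :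
    (openGraph η).edist x y ≤ (m + 1 : ℕ) := by
  obtain ⟨a, ha, hay⟩ := h
  obtain ⟨l, rfl⟩ : ∃ l, m = l + 1 := ⟨m - 1, by omega⟩
  have hne : a ≠ y := by
    rintro rfl
    exact notMem_box_of_abs_lt hd hy (by omega : M ≤ b + (l + 1)) (reach_subset (boxLayers x b) η (l + 1) ha)
  calc _ ≤ (openGraph η).edist x a + (openGraph η).edist a y := SimpleGraph.edist_triangle
    _ ≤ (l + 1 : ℕ) + 1 := add_le_add
        (edist_le_of_mem_reach (pairwise_disjoint_boxLayers hd hx hb) rfl η ha)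
        (SimpleGraph.edist_eq_one_iff_adj.2 (openGraph_adj.2 ⟨hay, hne⟩)).le
    _ = _ := by push_cast; rfl

/-- One `t` serves all edges: the vertices involved have coordinates at most `2 ^ (b + m + 1)` in
absolute value, hence mutual distance at most `d * 2 ^ (b + m + 2)`. Likewise `N` is a common lower
bound for the sizes of the boxes. -/
theorem edgeLaw_compl_pathEvent_le (hd : 1 ≤ d) {x y : Fin d → ℤ} (hxy : x ≠ y) {m M b : ℕ}
    (hx : ∀ i, |x i| < 2 ^ M) (hy : ∀ i, |y i| < 2 ^ M) (hb : M ≤ b) {α κ : ℝ} (hα : 0 < α)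
    (hκ : 0 < κ) {p : Sym2 (Fin d → ℤ) → unitInterval}
    (hp : ∀ a c, a ≠ c → 1 - (p s(a, c) : ℝ) ≤ Real.exp (-(κ / l1Dist a c ^ α))) {N t : ℝ}
    (hN : N = (2 ^ b) ^ d) (ht : t = κ / (d * 2 ^ (b + (m + 1) + 1)) ^ α)
    (ha : 1 ≤ N * t / 4) (hat : (N * t / 4) ^ (m - 1) * t ≤ 1) :
    edgeLaw p (pathEvent x y m b)ᶜ ≤ ENNReal.ofReal (Real.exp (-((N * t / 4) ^ m * t))) +
        m * ENNReal.ofReal (Real.exp (-(N * t / 4))) := by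
  have hA := pairwise_disjoint_boxLayers hd hx hb
  have ht0 : 0 ≤ t := by rw [ht]; positivity
  have hN0 : 0 ≤ N := by rw [hN]; positivity
  have hpt : ∀ a c, (∀ i, |a i| ≤ 2 ^ (b + (m + 1))) → (∀ i, |c i| ≤ 2 ^ (b + (m + 1))) →
      a ≠ c → 1 - (p s(a, c) : ℝ) ≤ Real.exp (-t) := by
    intro a c ha hc hac
    refine (hp a c hac).trans (Real.exp_le_exp.2 (neg_le_neg ?_))
    have h1 := one_le_l1Dist hac
    have h2 := l1Dist_le ha hc
    rw [ht]
    gcongr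
  have hyA : ∀ j ≤ m, y ∉ boxLayers x b j := by
    intro j hj hyj
    match j with
    | 0 => exact hxy (Finset.mem_singleton.1 hyj).symm
    | j + 1 => exact notMem_box_of_abs_lt hd hy (by omega) hyj
  refine (edgeLaw_not_exists_reach_le hyA (t := t) fun a ha => ?_).trans
    (lintegral_exp_card_reach_le hA rfl ht0 hN0 ?_ ?_ ha hat)
  · refine hpt a y (abs_le_of_mem_boxLayers hx hb ha (by omega))
      (fun i => (hy i).le.trans (pow_le_pow_right₀ (by norm_num) (by omega))) ?_
    rintro rfl
    exact hyA m le_rfl ha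
  · intro j hj _
    obtain ⟨l, rfl⟩ : ∃ l, j = l + 1 := ⟨j - 1, by omega⟩
    simp only [boxLayers, card_box, hN]
    push_cast
    gcongr
    · norm_num
    · omega
  · intro j hj a ha z hz
    refine hpt a z (abs_le_of_mem_boxLayers hx hb ha (by omega))
      (abs_le_of_mem_boxLayers hx hb hz (by omega)) ?_
    rintro rfl
    exact Finset.disjoint_left.1 (hA (by omega : j ≠ j + 1)) ha hz

end Lattice

open Filter Topology

/-! ### Exponents at large scale. -/

section Asymptotics

/-- The growth factor `a` has order `R ^ (d - α)`, so `a ^ j * t` has order `R ^ (j * (d - α) - α)`.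
The two inequalities on `m` make this exponent negative for `j = m - 1` and nonnegative for `j = m`.
It may vanish for `j = m`, so the failure probability is only kept away from `1`. -/
theorem eventually_scale_bounds {d α κ : ℝ} {m : ℕ} (hκ : 0 < κ) (hα : α < d) (hm : 1 ≤ m)
    (h1 : m * (d - α) < d) (h2 : d ≤ (m + 1) * (d - α)) :
    ∃ δ > 0, ∀ᶠ R : ℝ in atTop, 1 ≤ R ^ d * (κ / R ^ α) / 4 ∧
      (R ^ d * (κ / R ^ α) / 4) ^ (m - 1) * (κ / R ^ α) ≤ 1 ∧
      Real.exp (-((R ^ d * (κ / R ^ α) / 4) ^ m * (κ / R ^ α))) +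
        m * Real.exp (-(R ^ d * (κ / R ^ α) / 4)) ≤ 1 - δ := by
  have e1 : ∀ R : ℝ, 0 < R → R ^ d * (κ / R ^ α) / 4 = κ / 4 * R ^ (d - α) := by
    intro R hR
    rw [Real.rpow_sub hR]
    ring
  have e2 : ∀ (R : ℝ) (j : ℕ), 0 < R → (R ^ d * (κ / R ^ α) / 4) ^ j * (κ / R ^ α) =
      (κ / 4) ^ j * κ * R ^ (j * (d - α) - α) := by
    intro R j hR
    rw [e1 R hR, mul_pow, ← Real.rpow_mul_natCast hR.le, Real.rpow_sub hR, mul_comm (d - α)]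
    ring
  set δ₀ : ℝ := (κ / 4) ^ m * κ with hδ₀
  have hδ₀' : 0 < δ₀ := by positivity
  have hexp : Real.exp (-δ₀) < 1 := by simpa using hδ₀'
  have ta : Tendsto (fun R : ℝ => κ / 4 * R ^ (d - α)) atTop atTop :=
    (tendsto_rpow_atTop (by linarith)).const_mul_atTop (by positivity)
  have tb : Tendsto (fun R : ℝ => (κ / 4) ^ (m - 1) * κ * R ^ (((m - 1 : ℕ) : ℝ) * (d - α) - α))
      atTop (𝓝 0) := by
    have hneg : 0 < -(((m - 1 : ℕ) : ℝ) * (d - α) - α) := by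
      rw [Nat.cast_sub hm, Nat.cast_one]
      linarith
    have := (tendsto_rpow_neg_atTop hneg).const_mul ((κ / 4) ^ (m - 1) * κ)
    simpa using this
  have tc : Tendsto (fun R : ℝ => (m : ℝ) * Real.exp (-(κ / 4 * R ^ (d - α)))) atTop (𝓝 0) := by
    have := (Real.tendsto_exp_neg_atTop_nhds_zero.comp ta).const_mul (m : ℝ)
    simpa using this
  -- The main term is at most `exp (-δ₀)`; half of the remaining gap to `1` absorbs the error term,
  -- which tends to `0`.
  refine ⟨(1 - Real.exp (-δ₀)) / 2, by linarith, ?_⟩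
  filter_upwards [eventually_ge_atTop 1, ta.eventually_ge_atTop 1,
    tb.eventually_le_const one_pos,
    tc.eventually_le_const (show 0 < (1 - Real.exp (-δ₀)) / 2 by linarith)] with R hR ha hb hc
  have hR0 : 0 < R := by linarith
  refine ⟨by rwa [e1 R hR0], by rwa [e2 R _ hR0], ?_⟩
  rw [e2 R m hR0, e1 R hR0]
  have h3 : 1 ≤ R ^ ((m : ℝ) * (d - α) - α) := Real.one_le_rpow hR (by linarith)
  have h4 : Real.exp (-((κ / 4) ^ m * κ * R ^ ((m : ℝ) * (d - α) - α))) ≤ Real.exp (-δ₀) := by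
    apply Real.exp_le_exp.2
    nlinarith
  linarith

end Asymptotics

/-! ### Connection through some block of boxes. -/

section LongRange

variable {d : ℕ}

theorem ae_edist_le_of_exp_le (hd : 1 ≤ d) {α κ : ℝ} (hα : 0 < α) (hαd : α < d) (hκ : 0 < κ)
    {m : ℕ} (hm : 1 ≤ m) (h1 : m * (d - α) < d) (h2 : d ≤ (m + 1) * (d - α))
    {p : Sym2 (Fin d → ℤ) → unitInterval}
    (hp : ∀ a c, a ≠ c → 1 - (p s(a, c) : ℝ) ≤ Real.exp (-(κ / l1Dist a c ^ α)))
    {x y : Fin d → ℤ} (hxy : x ≠ y) {M : ℕ} (hx : ∀ i, |x i| < 2 ^ M) (hy : ∀ i, |y i| < 2 ^ M) :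
    ∀ᵐ η ∂edgeLaw p, ∃ n, η ∈ pathEvent x y m ((m + 1) * (n + M)) := by
  have hd0 : (0 : ℝ) < d := by exact_mod_cast hd
  -- With `R = 2 ^ b`, the distance bound `d * 2 ^ (b + m + 2)` is `C * R`, so `C ^ α` is absorbed
  -- into `κ`.
  set C : ℝ := d * 2 ^ (m + 2) with hC
  have hC0 : 0 < C := by positivity
  obtain ⟨δ, hδ, hev⟩ := eventually_scale_bounds (d := d) (α := α) (κ := κ / C ^ α) (m := m)
    (by positivity) hαd hm h1 h2
  have hb : Tendsto (fun n : ℕ => (2 : ℝ) ^ ((m + 1) * (n + M))) atTop atTop := by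
    refine (tendsto_pow_atTop_atTop_of_one_lt one_lt_two).comp ?_
    refine tendsto_atTop_mono (fun n => ?_) tendsto_id
    simp only [id]
    nlinarith
  have hfreq := frequently_mem_of_dependsOn (fun e => bernoulliMeasure true false (p e))
    (F := fun n => pathEdges x y m ((m + 1) * (n + M)))
    (E := fun n => pathEvent x y m ((m + 1) * (n + M)))
    (fun n n' hnn => disjoint_pathEdges hd hm hx hy (by nlinarith) (by omega))
    (fun n => measurableSet_of_dependsOn (dependsOn_pathEvent x y m _))
    (fun n => dependsOn_pathEvent x y m _) (δ := ENNReal.ofReal δ) (by simpa using hδ) ?_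
  · filter_upwards [hfreq] with η hη using hη.exists
  filter_upwards [hb.eventually hev] with n hn
  set b := (m + 1) * (n + M) with hbdef
  set R : ℝ := 2 ^ b with hR
  have hR0 : 0 < R := by positivity
  have ht : κ / C ^ α / R ^ α = κ / (d * 2 ^ (b + (m + 1) + 1)) ^ α := by
    rw [div_div, ← Real.mul_rpow hC0.le hR0.le]
    congr 2
    rw [hC, hR]
    ring
  obtain ⟨ha, hat, hle⟩ := hn
  have hmeas : MeasurableSet (pathEvent x y m b) :=
    measurableSet_of_dependsOn (dependsOn_pathEvent x y m _)
  have hc := edgeLaw_compl_pathEvent_le hd hxy hx hy (b := b) (by nlinarith) hα hκ hp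
    (N := R ^ (d : ℝ)) (Real.rpow_natCast _ _) ht ha hat
  rw [← ENNReal.ofReal_natCast, ← ENNReal.ofReal_mul (by positivity),
    ← ENNReal.ofReal_add (by positivity) (by positivity)] at hc
  have hc2 := hc.trans (ENNReal.ofReal_le_ofReal hle)
  have h3 := prob_compl_eq_one_sub hmeas.compl (μ := edgeLaw p)
  rw [compl_compl] at h3
  rw [h3]
  calc ENNReal.ofReal δ = 1 - ENNReal.ofReal (1 - δ) := by
        rw [← ENNReal.ofReal_one, ← ENNReal.ofReal_sub _ ?_]
        · congr 1; ring
        · exact le_trans (by positivity) hle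
    _ ≤ _ := tsub_le_tsub_left hc2 1

end LongRange

/-! ### Components and diameters of a graph with bounded distances. -/

section Graph

variable {V : Type*} {G : SimpleGraph V}

theorem connectedComponent_of_edist_le [Infinite V] {k : ℕ} (h : ∀ x y, G.edist x y ≤ k) :
    (∃! C : G.ConnectedComponent, C.supp.Infinite) ∧
      ∀ C : G.ConnectedComponent, C.supp = Set.univ := by
  have hr : ∀ x y, G.Reachable x y := fun x y =>
    SimpleGraph.reachable_of_edist_ne_top ((h x y).trans_lt (ENat.natCast_lt_top k)).ne
  have hs : ∀ C : G.ConnectedComponent, C.supp = Set.univ := by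
    intro C
    induction C using SimpleGraph.ConnectedComponent.ind with
    | _ v =>
      ext w
      simpa using hr w v
  obtain ⟨v⟩ := (inferInstance : Nonempty V)
  refine ⟨⟨G.connectedComponentMk v, ?_, fun C _ => ?_⟩, hs⟩
  · show (G.connectedComponentMk v).supp.Infinite
    rw [hs]
    exact Set.infinite_univ
  · induction C using SimpleGraph.ConnectedComponent.ind with
    | _ w => exact SimpleGraph.ConnectedComponent.eq.2 (hr w v)

theorem ediam_toSimpleGraph_of_supp_eq_univ {C : G.ConnectedComponent}
    (hC : C.supp = Set.univ) : C.toSimpleGraph.ediam = G.ediam := by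
  have e : ∀ u v : C, C.toSimpleGraph.edist u v = G.edist u v := by
    intro u v
    refine le_antisymm ?_ ?_
    · by_cases hr : G.Reachable u v
      · obtain ⟨w, hw⟩ := hr.exists_walk_length_eq_edist
        have hsub : ∀ z ∈ w.support, z ∈ C.supp := fun z _ => hC ▸ Set.mem_univ z
        have hl : (w.induce C.supp hsub).length = w.length :=
          (SimpleGraph.Walk.length_map _ _).symm.trans
            (congrArg SimpleGraph.Walk.length (SimpleGraph.Walk.map_induce w hsub))
        rw [← hw, ← hl]
        exact SimpleGraph.edist_le _
      · rw [SimpleGraph.edist_eq_top_of_not_reachable hr]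
        exact le_top
    · by_cases hr : C.toSimpleGraph.Reachable u v
      · obtain ⟨w, hw⟩ := hr.exists_walk_length_eq_edist
        rw [← hw, ← w.length_map C.toSimpleGraph_hom]
        exact SimpleGraph.edist_le _
      · rw [SimpleGraph.edist_eq_top_of_not_reachable hr]
        exact le_top
  have hmem : ∀ v, v ∈ C.supp := fun v => hC ▸ Set.mem_univ v
  refine le_antisymm ?_ ?_
  · exact SimpleGraph.ediam_le_of_edist_le fun u v => (e u v).trans_le SimpleGraph.edist_le_ediam
  · exact SimpleGraph.ediam_le_of_edist_le fun u v =>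
      (e ⟨u, hmem u⟩ ⟨v, hmem v⟩).symm.trans_le SimpleGraph.edist_le_ediam

theorem two_le_ediam {a b : V} (hab : a ≠ b) (h : ¬ G.Adj a b) : 2 ≤ G.ediam := by
  refine le_trans ?_ (SimpleGraph.edist_le_ediam (u := a) (v := b))
  by_contra hlt
  rw [not_le] at hlt
  have h1 : G.edist a b ≤ 1 := by
    rw [← one_add_one_eq_two] at hlt
    exact ENat.lt_add_one_iff (by simp) |>.1 hlt
  have h0 : G.edist a b ≠ 0 := by
    rwa [Ne, SimpleGraph.edist_eq_zero_iff]
  exact h (SimpleGraph.edist_eq_one_iff_adj.1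
    (le_antisymm h1 (Order.one_le_iff_ne_zero.2 h0)))

end Graph

/-! ### Consequences of the weight distribution: hubs and light pairs. -/

section Weights

variable {d : ℕ}

theorem one_sub_edgeProb {lam α w : ℝ} (hlam : 0 < lam) (hw : 0 < w) {W : (Fin d → ℤ) → ℝ}
    (hW : ∀ x, w ≤ W x) (a b : Fin d → ℤ) :
    1 - (edgeProb lam α W s(a, b) : ℝ) =
      Real.exp (-(lam * (W a * W b / l1Dist a b ^ α))) := by
  have hD : 0 ≤ l1Dist a b := Finset.sum_nonneg fun _ _ => abs_nonneg _
  have ha := hw.le.trans (hW a)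
  have hb := hw.le.trans (hW b)
  have h0 : 0 ≤ lam * (W a * W b / l1Dist a b ^ α) := by positivity
  have h1 : Real.exp (-(lam * (W a * W b / l1Dist a b ^ α))) ≤ 1 :=
    Real.exp_le_one_iff.2 (by linarith)
  have h3 := Real.exp_nonneg (-(lam * (W a * W b / l1Dist a b ^ α)))
  have h2 : edgeFun lam α W s(a, b) ∈ Set.Icc (0 : ℝ) 1 :=
    ⟨by simp only [edgeFun, Sym2.lift_mk]; linarith,
      by simp only [edgeFun, Sym2.lift_mk]; linarith⟩
  rw [edgeProb, Set.projIcc_of_mem _ h2]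
  simp [edgeFun]

theorem ae_forall_le_weight {w : ℝ} {μ : Measure ℝ} [IsProbabilityMeasure μ]
    (h : ∀ᵐ t ∂μ, w ≤ t) :
    ∀ᵐ W ∂Measure.infinitePi fun _ : Fin d → ℤ => μ, ∀ x, w ≤ W x := by
  rw [ae_all_iff]
  intro x
  have := (measurePreserving_eval_infinitePi (fun _ : Fin d → ℤ => μ) x).quasiMeasurePreserving
  exact this.ae h

theorem exists_pos_ae_le {c τ : ℝ} (hτ : 1 < τ) (hc : 0 < c) {μ : Measure ℝ}
    [IsProbabilityMeasure μ]
    (hμ : ∀ w : ℝ, 0 < w → min (c * w ^ (-(τ - 1))) 1 ≤ μ.real (Set.Ici w)) :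
    ∃ w : ℝ, 0 < w ∧ ∀ᵐ t ∂μ, w ≤ t := by
  refine ⟨c ^ (1 / (τ - 1)), by positivity, ?_⟩
  have h := hμ (c ^ (1 / (τ - 1))) (by positivity)
  have h1 : c * (c ^ (1 / (τ - 1))) ^ (-(τ - 1)) = 1 := by
    have : 1 / (τ - 1) * (-(τ - 1)) = -1 := by
      field_simp [sub_ne_zero.2 hτ.ne']
    rw [← Real.rpow_mul hc.le, this, Real.rpow_neg_one, mul_inv_cancel₀ hc.ne']
  rw [h1, min_self] at h
  have h2 : μ (Set.Ici (c ^ (1 / (τ - 1)))) = 1 := by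
    rw [← ofReal_measureReal, le_antisymm measureReal_le_one h, ENNReal.ofReal_one]
  exact (mem_ae_iff_prob_eq_one measurableSet_Ici).2 h2

/-- With `θ = 2 ^ (n α)`, the expected number of vertices of weight at least `θ` in the box is at
least `min c 1`, because `2 ^ (n d) * θ ^ (-(τ - 1)) ≥ 1` is exactly the assumption `γ ≤ 1`. By
independence there is none with probability at most `exp (-min c 1)`. -/
theorem ae_frequently_exists_large_weight (hd : 1 ≤ d) {α τ c : ℝ}
    (hc : 0 < c) (hγ : α * (τ - 1) ≤ d) {μ : Measure ℝ} [IsProbabilityMeasure μ]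
    (hμ : ∀ w : ℝ, 0 < w → min (c * w ^ (-(τ - 1))) 1 ≤ μ.real (Set.Ici w)) :
    ∀ᵐ W ∂Measure.infinitePi fun _ : Fin d → ℤ => μ,
      ∃ᶠ n : ℕ in atTop, ∃ z ∈ box d n, ((2 : ℝ) ^ n) ^ α ≤ W z := by
  set P := Measure.infinitePi fun _ : Fin d → ℤ => μ with hP
  set δ : ℝ := min c 1 with hδ
  have hδ0 : 0 < δ := by positivity
  set E : ℕ → Set ((Fin d → ℤ) → ℝ) := fun n =>
    {W | ∃ z ∈ box d n, ((2 : ℝ) ^ n) ^ α ≤ W z} with hE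
  have hcompl : ∀ n, (E n)ᶜ =
      (box d n : Set (Fin d → ℤ)).pi fun _ => Set.Iio (((2 : ℝ) ^ n) ^ α) := by
    intro n
    ext W
    simp [hE, Set.mem_pi]
  have hmc : ∀ n, MeasurableSet (E n)ᶜ := fun n => by
    rw [hcompl]
    exact MeasurableSet.pi (Finset.countable_toSet _) fun _ _ => measurableSet_Iio
  have hm : ∀ n, MeasurableSet (E n) := fun n => by simpa using (hmc n).compl
  refine frequently_mem_of_dependsOn (fun _ : Fin d → ℤ => μ) (F := fun n => box d n) (E := E)
    (fun n n' hnn => Finset.disjoint_left.2 fun z hz hz' => hnn (eq_of_mem_box hd hz hz')) hm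
    (fun n W W' h => ?_) (δ := 1 - ENNReal.ofReal (Real.exp (-δ))) ?_ (Eventually.of_forall ?_)
  · have h' : ∀ z ∈ box d n, W z = W' z := h
    refine propext <| exists_congr fun z => and_congr_right fun hz => ?_
    rw [h' z hz]
  · rw [← pos_iff_ne_zero, tsub_pos_iff_lt, ENNReal.ofReal_lt_one]
    simpa using hδ0
  intro n
  have h3 := prob_compl_eq_one_sub (hmc n) (μ := P)
  rw [compl_compl] at h3
  rw [h3]
  refine tsub_le_tsub_left ?_ 1
  set θ : ℝ := ((2 : ℝ) ^ n) ^ α with hθ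
  have hθ0 : 0 < θ := by positivity
  have hN : (1 : ℝ) ≤ (2 ^ n) ^ d := one_le_pow₀ (one_le_pow₀ one_le_two)
  have htail : δ ≤ ((2 : ℝ) ^ n) ^ d * μ.real (Set.Ici θ) := by
    have h4 : θ ^ (-(τ - 1)) = ((2 : ℝ) ^ n) ^ (-(α * (τ - 1))) := by
      rw [hθ, ← Real.rpow_mul (by positivity)]
      congr 1
      ring
    have h5 : 1 ≤ ((2 : ℝ) ^ n) ^ d * ((2 : ℝ) ^ n) ^ (-(α * (τ - 1))) := by
      rw [← Real.rpow_natCast _ d, ← Real.rpow_add (by positivity)]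
      exact Real.one_le_rpow (one_le_pow₀ one_le_two) (by linarith)
    refine le_trans ?_ (mul_le_mul_of_nonneg_left (hμ θ hθ0) (by positivity))
    rw [h4]
    rcases min_cases (c * ((2 : ℝ) ^ n) ^ (-(α * (τ - 1)))) 1 with ⟨h6, -⟩ | ⟨h6, -⟩
    · rw [h6]
      calc δ ≤ c * 1 := by rw [mul_one]; exact min_le_left _ _
        _ ≤ c * (((2 : ℝ) ^ n) ^ d * ((2 : ℝ) ^ n) ^ (-(α * (τ - 1)))) := by gcongr
        _ = _ := by ring
    · rw [h6, mul_one]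
      exact (min_le_right _ _).trans hN
  have hIio : μ (Set.Iio θ) ≤ ENNReal.ofReal (Real.exp (-μ.real (Set.Ici θ))) := by
    rw [← ofReal_measureReal, ← Set.compl_Ici, probReal_compl_eq_one_sub measurableSet_Ici]
    exact ENNReal.ofReal_le_ofReal (Real.one_sub_le_exp_neg _)
  calc P (E n)ᶜ = ∏ _z ∈ box d n, μ (Set.Iio θ) := by
        rw [hcompl]
        exact Measure.infinitePi_pi _ fun _ _ => measurableSet_Iio
    _ ≤ ∏ _z ∈ box d n, ENNReal.ofReal (Real.exp (-μ.real (Set.Ici θ))) :=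
        Finset.prod_le_prod' fun _ _ => hIio
    _ ≤ ENNReal.ofReal (Real.exp (-δ)) := by
        rw [Finset.prod_const, card_box, ← ENNReal.ofReal_pow (Real.exp_nonneg _),
          ← Real.exp_nat_mul]
        refine ENNReal.ofReal_le_ofReal (Real.exp_le_exp.2 ?_)
        push_cast
        linarith

theorem ae_frequently_small_weights {v : ℕ → Fin d → ℤ} (hv : Function.Injective v)
    (μ : Measure ℝ) [IsProbabilityMeasure μ] :
    ∃ K : ℝ, ∀ᵐ W ∂Measure.infinitePi fun _ : Fin d → ℤ => μ,
      ∃ᶠ n : ℕ in atTop, W (v (2 * n)) ≤ K ∧ W (v (2 * n + 1)) ≤ K := by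
  classical
  obtain ⟨K, hK⟩ : ∃ K : ℝ, μ (Set.Iic K) ≠ 0 := by
    by_contra! h
    have h1 : μ (⋃ n : ℕ, Set.Iic (n : ℝ)) = 0 := measure_iUnion_null fun n => h n
    have h2 : (⋃ n : ℕ, Set.Iic (n : ℝ)) = Set.univ :=
      Set.eq_univ_of_forall fun t => Set.mem_iUnion.2 (exists_nat_ge t)
    rw [h2, measure_univ] at h1
    exact one_ne_zero h1
  refine ⟨K, ?_⟩
  set F : ℕ → Finset (Fin d → ℤ) := fun n => {v (2 * n), v (2 * n + 1)} with hF
  set E : ℕ → Set ((Fin d → ℤ) → ℝ) := fun n =>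
    {W | W (v (2 * n)) ≤ K ∧ W (v (2 * n + 1)) ≤ K} with hE
  have hpi : ∀ n, E n = (F n : Set (Fin d → ℤ)).pi fun _ => Set.Iic K := by
    intro n
    ext W
    simp [hE, hF]
  refine frequently_mem_of_dependsOn (fun _ : Fin d → ℤ => μ) (F := F) (E := E)
    (fun n n' hnn => ?_) (fun n => ?_) (fun n W W' h => ?_) (δ := μ (Set.Iic K) ^ 2)
    (pow_ne_zero 2 hK) (Eventually.of_forall fun n => ?_)
  · refine Finset.disjoint_left.2 ?_
    intro z hz hz'
    simp only [hF, Finset.mem_insert, Finset.mem_singleton] at hz hz'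
    rcases hz with rfl | rfl <;> rcases hz' with h | h <;> have := hv h <;> omega
  · rw [hpi]
    exact MeasurableSet.pi (Finset.countable_toSet _) fun _ _ => measurableSet_Iic
  · have h1 : W (v (2 * n)) = W' (v (2 * n)) := h _ (by simp [hF])
    have h2 : W (v (2 * n + 1)) = W' (v (2 * n + 1)) := h _ (by simp [hF])
    simp only [hE, Set.mem_ofPred_eq, h1, h2]
  · rw [hpi, Measure.infinitePi_pi _ fun _ _ => measurableSet_Iic, Finset.prod_const]
    rw [Finset.card_pair (hv.ne (by omega))]

theorem ae_exists_common_neighbour (hd : 1 ≤ d) {lam α w : ℝ} (hlam : 0 < lam)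
    (hα : 0 < α) (hw : 0 < w) {W : (Fin d → ℤ) → ℝ} (hW : ∀ x, w ≤ W x)
    (hfreq : ∃ᶠ n : ℕ in atTop, ∃ z ∈ box d n, ((2 : ℝ) ^ n) ^ α ≤ W z)
    {x y : Fin d → ℤ} (hxy : x ≠ y) :
    ∀ᵐ η ∂edgeMeasure lam α W, ∃ z, z ≠ x ∧ z ≠ y ∧ η s(x, z) = true ∧ η s(z, y) = true := by
  classical
  obtain ⟨M₁, hx'⟩ := exists_abs_lt_two_pow x
  obtain ⟨M₂, hy'⟩ := exists_abs_lt_two_pow y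
  set M := max M₁ M₂
  have hx : ∀ i, |x i| < 2 ^ M := fun i =>
    (hx' i).trans_le (pow_le_pow_right₀ (by norm_num) (le_max_left _ _))
  have hy : ∀ i, |y i| < 2 ^ M := fun i =>
    (hy' i).trans_le (pow_le_pow_right₀ (by norm_num) (le_max_right _ _))
  obtain ⟨φ, hφ, hz⟩ := extraction_of_frequently_atTop (hfreq.and_eventually (eventually_ge_atTop M))
  choose hz hφM using hz
  choose z hzbox hzW using hz
  have hzx : ∀ n, z n ≠ x := fun n h =>
    notMem_box_of_abs_lt hd hx (hφM n) (h ▸ hzbox n)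
  have hzy : ∀ n, z n ≠ y := fun n h =>
    notMem_box_of_abs_lt hd hy (hφM n) (h ▸ hzbox n)
  have hzinj : ∀ n n', z n = z n' → n = n' := fun n n' h =>
    hφ.injective (eq_of_mem_box hd (hzbox n) (h ▸ hzbox n'))
  have hd0 : (0 : ℝ) < d := by exact_mod_cast hd
  -- A hub in box `φ n` has weight at least `2 ^ (φ n * α)` and lies within `4 * d * 2 ^ φ n` of `x`
  -- and `y`. The powers of `2 ^ φ n` cancel, so `q` is free of `n`.
  set q : ℝ := 1 - Real.exp (-(lam * w / (d * 4) ^ α)) with hq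
  have hq0 : 0 < q := by
    have : 0 < lam * w / (d * 4) ^ α := by positivity
    have : Real.exp (-(lam * w / (d * 4) ^ α)) < 1 := by simpa using this
    linarith
  have hprob : ∀ u : Fin d → ℤ, (∀ i, |u i| < 2 ^ M) → ∀ n, z n ≠ u →
      q ≤ edgeProb lam α W s(u, z n) := by
    intro u hu n hne
    have h1 := one_sub_edgeProb (α := α) hlam hw hW u (z n)
    have h2 := one_le_l1Dist hne.symm
    have h3 : l1Dist u (z n) ≤ d * 2 ^ (φ n + 1 + 1) := l1Dist_le
      (fun i => (hu i).le.trans (pow_le_pow_right₀ (by norm_num) ((hφM n).trans (by omega))))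
      (abs_le_of_mem_box (hzbox n) (by omega))
    have h4 : lam * w / (d * 4) ^ α ≤ lam * (W u * W (z n) / l1Dist u (z n) ^ α) := by
      have h5 : lam * w / (d * 4) ^ α =
          lam * (w * ((2 : ℝ) ^ φ n) ^ α / (d * 2 ^ (φ n + 1 + 1)) ^ α) := by
        rw [show (d : ℝ) * 2 ^ (φ n + 1 + 1) = d * 4 * 2 ^ φ n by ring,
          Real.mul_rpow (x := d * 4) (y := 2 ^ φ n) (by positivity) (by positivity),
          mul_div_mul_right _ _ (by positivity), mul_div_assoc]
      rw [h5]
      have := hw.le.trans (hW u)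
      gcongr
      exacts [mul_nonneg this (hw.le.trans (hW _)), hW u, hzW n]
    have h6 := Real.exp_le_exp.2 (neg_le_neg h4)
    linarith
  set E : ℕ → Set (Sym2 (Fin d → ℤ) → Bool) := fun n =>
    {η | η s(x, z n) = true ∧ η s(z n, y) = true} with hE
  set F : ℕ → Finset (Sym2 (Fin d → ℤ)) := fun n => {s(x, z n), s(z n, y)} with hF
  have hdep : ∀ n, DependsOn (· ∈ E n) (F n : Set (Sym2 (Fin d → ℤ))) := by
    intro n η η' h
    have h1 : η s(x, z n) = η' s(x, z n) := h _ (by simp [hF])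
    have h2 : η s(z n, y) = η' s(z n, y) := h _ (by simp [hF])
    simp only [hE, Set.mem_ofPred_eq, h1, h2]
  have h := frequently_mem_of_dependsOn
    (fun e => bernoulliMeasure true false (edgeProb lam α W e)) (F := F) (E := E)
    (fun n n' hnn => ?_) (fun n => measurableSet_of_dependsOn (hdep n)) hdep
    (δ := ENNReal.ofReal q * ENNReal.ofReal q) (by simpa using hq0)
    (Eventually.of_forall fun n => ?_)
  · filter_upwards [h] with η hη
    obtain ⟨n, hn⟩ := hη.exists
    exact ⟨z n, hzx n, hzy n, hn⟩
  · refine Finset.disjoint_left.2 ?_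
    intro e he he'
    have hmem : ∀ {n e}, e ∈ F n → z n ∈ e ∧ ∀ v ∈ e, v = x ∨ v = y ∨ v = z n := by
      intro n e he
      simp only [hF, Finset.mem_insert, Finset.mem_singleton] at he
      rcases he with rfl | rfl
      · refine ⟨by simp, fun v hv => ?_⟩
        rcases Sym2.mem_iff.1 hv with h | h <;> simp [h]
      · refine ⟨by simp, fun v hv => ?_⟩
        rcases Sym2.mem_iff.1 hv with h | h <;> simp [h]
    rcases (hmem he').2 _ (hmem he).1 with h | h | h
    exacts [hzx n h, hzy n h, hnn (hzinj _ _ h)]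
  · have hEF : E n = {η | ∀ e ∈ F n, η e = true} := by
      ext η
      simp [hE, hF]
    have hne : s(x, z n) ≠ s(z n, y) := by
      intro h
      rcases Sym2.eq_iff.1 h with ⟨h1, -⟩ | ⟨h1, -⟩
      exacts [hzx n h1.symm, hxy h1]
    rw [hEF]
    refine le_trans ?_ (edgeLaw_open (edgeProb lam α W) (F n)).ge
    rw [Finset.prod_pair hne, Sym2.eq_swap (a := z n)]
    exact mul_le_mul' (ENNReal.ofReal_le_ofReal (hprob x hx n (hzx n)))
      (ENNReal.ofReal_le_ofReal (hprob y hy n (hzy n)))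

/-- Distinct vertices are at distance at least `1`, so each edge between two vertices of weight at
most `K` is closed with probability at least `exp (-lam * K ^ 2)`, and there are infinitely many
such edges. -/
theorem ae_exists_closed_edge {lam α w K : ℝ} (hlam : 0 < lam) (hα : 0 < α) (hw : 0 < w)
    {W : (Fin d → ℤ) → ℝ} (hW : ∀ x, w ≤ W x) {v : ℕ → Fin d → ℤ} (hv : Function.Injective v)
    (hfreq : ∃ᶠ n : ℕ in atTop, W (v (2 * n)) ≤ K ∧ W (v (2 * n + 1)) ≤ K) :
    ∀ᵐ η ∂edgeMeasure lam α W, ∃ a b, a ≠ b ∧ η s(a, b) = false := by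
  classical
  obtain ⟨φ, hφ, hK⟩ := extraction_of_frequently_atTop hfreq
  set e : ℕ → Sym2 (Fin d → ℤ) := fun n => s(v (2 * φ n), v (2 * φ n + 1)) with he
  have heinj : ∀ n n', e n = e n' → n = n' := by
    intro n n' h
    apply hφ.injective
    rcases Sym2.eq_iff.1 h with ⟨h1, -⟩ | ⟨h1, -⟩ <;> have := hv h1 <;> omega
  have hne : ∀ n, v (2 * φ n) ≠ v (2 * φ n + 1) := fun n => hv.ne (by omega)
  set E : ℕ → Set (Sym2 (Fin d → ℤ) → Bool) := fun n => {η | η (e n) = false} with hE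
  have hdep : ∀ n, DependsOn (· ∈ E n) (({e n} : Finset (Sym2 (Fin d → ℤ))) : Set _) := by
    intro n η η' h
    have h1 : η (e n) = η' (e n) := h _ (by simp)
    simp only [hE, Set.mem_ofPred_eq, h1]
  have h := frequently_mem_of_dependsOn
    (fun e => bernoulliMeasure true false (edgeProb lam α W e)) (F := fun n => {e n}) (E := E)
    (fun n n' hnn => by
      simp only [Finset.disjoint_singleton]
      exact fun h => hnn (heinj _ _ h))
    (fun n => measurableSet_of_dependsOn (hdep n)) hdep
    (δ := ENNReal.ofReal (Real.exp (-(lam * (K * K))))) (by simpa using Real.exp_pos _)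
    (Eventually.of_forall fun n => ?_)
  · filter_upwards [h] with η hη
    obtain ⟨n, hn⟩ := hη.exists
    exact ⟨_, _, hne n, hn⟩
  have hEF : E n = {η | ∀ e' ∈ ({e n} : Finset _), η e' = false} := by
    ext η
    simp [hE]
  rw [hEF]
  refine le_trans ?_ (edgeLaw_closed (edgeProb lam α W) {e n}).ge
  rw [Finset.prod_singleton, he, one_sub_edgeProb hlam hw hW]
  refine ENNReal.ofReal_le_ofReal (Real.exp_le_exp.2 (neg_le_neg ?_))
  obtain ⟨h1, h2⟩ := hK n
  have h3 := hw.le.trans (hW (v (2 * φ n)))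
  have h4 := hw.le.trans (hW (v (2 * φ n + 1)))
  have h5 : 1 ≤ l1Dist (v (2 * φ n)) (v (2 * φ n + 1)) ^ α :=
    Real.one_le_rpow (one_le_l1Dist (hne n)) hα.le
  have h6 : W (v (2 * φ n)) * W (v (2 * φ n + 1)) ≤ K * K :=
    mul_le_mul h1 h2 h4 (h3.trans h1)
  have h7 := div_le_self (mul_nonneg h3 h4) h5
  exact mul_le_mul_of_nonneg_left (h7.trans h6) hlam.le

end Weights

/-! ### From fixed weights to the joint law. -/

section Percolation

variable {d : ℕ}

theorem measurable_edge (e : Sym2 (Fin d → ℤ)) :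
    Measurable fun ω : ((Fin d → ℤ) → ℝ) × (Sym2 (Fin d → ℤ) → Bool) => ω.2 e := by
  fun_prop

theorem measurableSet_edge_eq (e : Sym2 (Fin d → ℤ)) (b : Bool) :
    MeasurableSet {ω : ((Fin d → ℤ) → ℝ) × (Sym2 (Fin d → ℤ) → Bool) | ω.2 e = b} :=
  measurable_edge e (measurableSet_singleton b)

theorem ae_edist_le_two (hd : 1 ≤ d) {lam α τ c : ℝ} (hlam : 0 < lam) (hα : 0 < α) (hτ : 1 < τ)
    (hc : 0 < c) (hγ : α * (τ - 1) ≤ d) {μ : Measure ℝ} [IsProbabilityMeasure μ]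
    (hμ : ∀ w : ℝ, 0 < w → min (c * w ^ (-(τ - 1))) 1 ≤ μ.real (Set.Ici w)) (x y : Fin d → ℤ) :
    ∀ᵐ ω ∂sfpMeasure d lam α μ, (openGraph ω.2).edist x y ≤ (2 : ℕ) := by
  by_cases hxy : x = y
  · simp [hxy]
  obtain ⟨w, hw, hwμ⟩ := exists_pos_ae_le hτ hc hμ
  -- Passing from almost all weights to the joint law needs a measurable event, so the claim is
  -- phrased through single edges rather than through `edist`.
  have h : ∀ᵐ ω ∂sfpMeasure d lam α μ,
      ∃ z, z ≠ x ∧ z ≠ y ∧ ω.2 s(x, z) = true ∧ ω.2 s(z, y) = true := by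
    refine Measure.ae_compProd_of_ae_ae ?_ ?_
    · simp only [Set.ofPred_exists, Set.ofPred_and]
      exact MeasurableSet.iUnion fun z => (MeasurableSet.const _).inter
        ((MeasurableSet.const _).inter
          ((measurableSet_edge_eq _ _).inter (measurableSet_edge_eq _ _)))
    · filter_upwards [ae_forall_le_weight hwμ,
        ae_frequently_exists_large_weight hd hc hγ hμ] with W hW hfreq
      exact ae_exists_common_neighbour hd hlam hα hw hW hfreq hxy
  filter_upwards [h] with ω ⟨z, hzx, hzy, h1, h2⟩
  calc _ ≤ (openGraph ω.2).edist x z + (openGraph ω.2).edist z y := SimpleGraph.edist_triangle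
    _ = 1 + 1 := by
      rw [SimpleGraph.edist_eq_one_iff_adj.2 (openGraph_adj.2 ⟨h1, hzx.symm⟩),
        SimpleGraph.edist_eq_one_iff_adj.2 (openGraph_adj.2 ⟨h2, hzy⟩)]
    _ ≤ (2 : ℕ) := by norm_num

theorem ae_exists_not_adj [Infinite (Fin d → ℤ)] {lam α w : ℝ} (hlam : 0 < lam) (hα : 0 < α)
    (hw : 0 < w) {μ : Measure ℝ} [IsProbabilityMeasure μ] (hwμ : ∀ᵐ t ∂μ, w ≤ t) :
    ∀ᵐ ω ∂sfpMeasure d lam α μ, ∃ a b, a ≠ b ∧ ¬ (openGraph ω.2).Adj a b := by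
  have hv := (Infinite.natEmbedding (Fin d → ℤ)).injective
  obtain ⟨K, hK⟩ := ae_frequently_small_weights hv μ
  have h : ∀ᵐ ω ∂sfpMeasure d lam α μ, ∃ a b, a ≠ b ∧ ω.2 s(a, b) = false := by
    refine Measure.ae_compProd_of_ae_ae ?_ ?_
    · simp only [Set.ofPred_exists, Set.ofPred_and]
      exact MeasurableSet.iUnion fun a => MeasurableSet.iUnion fun b =>
        (MeasurableSet.const _).inter (measurableSet_edge_eq _ _)
    · filter_upwards [ae_forall_le_weight hwμ, hK] with W hW hfreq
      exact ae_exists_closed_edge hlam hα hw hW hv hfreq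
  filter_upwards [h] with ω ⟨a, b, hab, hc⟩
  exact ⟨a, b, hab, fun hadj => by simp [(openGraph_adj.1 hadj).1] at hc⟩

theorem ae_edist_le_ceil (hd : 1 ≤ d) {lam α w : ℝ} (hlam : 0 < lam) (hα : 0 < α) (hαd : α < d)
    (hw : 0 < w) {μ : Measure ℝ} [IsProbabilityMeasure μ] (hwμ : ∀ᵐ t ∂μ, w ≤ t)
    (x y : Fin d → ℤ) :
    ∀ᵐ ω ∂sfpMeasure d lam α μ, (openGraph ω.2).edist x y ≤ (⌈(d : ℝ) / (d - α)⌉₊ : ℕ) := by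
  by_cases hxy : x = y
  · simp [hxy]
  have hdα : 0 < (d : ℝ) - α := by linarith
  set k := ⌈(d : ℝ) / (d - α)⌉₊ with hk
  -- Since `α > 0`, `d / (d - α) > 1`; so there is at least one intermediate box.
  have hk1 : 1 < k := by
    rw [hk, Nat.lt_ceil, Nat.cast_one, one_lt_div hdα]
    linarith
  obtain ⟨m, hkm⟩ : ∃ m, k = m + 1 := ⟨k - 1, by omega⟩
  have h1 : m * ((d : ℝ) - α) < d := by
    rw [← lt_div_iff₀ hdα, ← Nat.lt_ceil, ← hk]
    omega
  have h2 : (d : ℝ) ≤ (m + 1) * (d - α) := by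
    rw [← div_le_iff₀ hdα]
    have := Nat.le_ceil ((d : ℝ) / (d - α))
    rw [← hk, hkm] at this
    exact_mod_cast this
  obtain ⟨M₁, hx'⟩ := exists_abs_lt_two_pow x
  obtain ⟨M₂, hy'⟩ := exists_abs_lt_two_pow y
  set M := max M₁ M₂
  have hx : ∀ i, |x i| < 2 ^ M := fun i =>
    (hx' i).trans_le (pow_le_pow_right₀ (by norm_num) (le_max_left _ _))
  have hy : ∀ i, |y i| < 2 ^ M := fun i =>
    (hy' i).trans_le (pow_le_pow_right₀ (by norm_num) (le_max_right _ _))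
  have hm : 1 ≤ m := by omega
  have h : ∀ᵐ ω ∂sfpMeasure d lam α μ, ∃ n, ω.2 ∈ pathEvent x y m ((m + 1) * (n + M)) := by
    refine Measure.ae_compProd_of_ae_ae ?_ ?_
    · simp only [Set.ofPred_exists]
      exact MeasurableSet.iUnion fun n =>
        measurable_snd (measurableSet_of_dependsOn (dependsOn_pathEvent x y m _))
    · filter_upwards [ae_forall_le_weight hwμ] with W hW
      refine ae_edist_le_of_exp_le hd hα hαd (κ := lam * (w * w)) (by positivity) hm h1 h2
        (p := edgeProb lam α W) (fun a b hab => ?_) hxy hx hy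
      rw [one_sub_edgeProb hlam hw hW, mul_div_assoc lam (w * w)]
      have hD := one_le_l1Dist hab
      have ha := hw.le.trans (hW a)
      have hle : w * w ≤ W a * W b := mul_le_mul (hW a) (hW b) hw.le ha
      refine Real.exp_le_exp.2 (neg_le_neg ?_)
      gcongr
  filter_upwards [h] with ω ⟨n, hn⟩
  rw [hkm]
  exact edist_le_of_mem_pathEvent hd hm hx hy (by nlinarith) hn

end Percolation

end ScaleFreePercolation

theorem theorem2p1 (d : ℕ) (hd : 1 ≤ d) (lam α τ c : ℝ) (hlam : 0 < lam) (hα : 0 < α)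
    (hτ : 1 < τ) (hc : 0 < c) (μ : MeasureTheory.Measure ℝ)
    [MeasureTheory.IsProbabilityMeasure μ]
    (hμ : ∀ w : ℝ, 0 < w → min (c * w ^ (-(τ - 1))) 1 ≤ μ.real (Set.Ici w)) :
    (α * (τ - 1) / d ≤ 1 →
      ∀ᵐ ω ∂ScaleFreePercolation.sfpMeasure d lam α μ,
        (∃! C : (ScaleFreePercolation.openGraph ω.2).ConnectedComponent, C.supp.Infinite) ∧
        ∀ C : (ScaleFreePercolation.openGraph ω.2).ConnectedComponent, C.supp.Infinite →
          C.toSimpleGraph.ediam = 2) ∧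
    (α < d →
      ∀ᵐ ω ∂ScaleFreePercolation.sfpMeasure d lam α μ,
        (∃! C : (ScaleFreePercolation.openGraph ω.2).ConnectedComponent, C.supp.Infinite) ∧
        ∀ C : (ScaleFreePercolation.openGraph ω.2).ConnectedComponent, C.supp.Infinite →
          C.toSimpleGraph.ediam ≤ ((⌈(d : ℝ) / (d - α)⌉₊ : ℕ) : ℕ∞)) := by
  -- Makes `Fin d → ℤ` infinite by instance search.
  have : Nonempty (Fin d) := ⟨⟨0, hd⟩⟩
  obtain ⟨w, hw, hwμ⟩ := ScaleFreePercolation.exists_pos_ae_le hτ hc hμ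
  refine ⟨fun hγ => ?_, fun hαd => ?_⟩
  · have hγ' : α * (τ - 1) ≤ d := by
      rwa [div_le_one (by exact_mod_cast hd)] at hγ
    have h1 := ae_all_iff.2 fun x => ae_all_iff.2 fun y =>
      ScaleFreePercolation.ae_edist_le_two hd hlam hα hτ hc hγ' hμ x y
    filter_upwards [h1, ScaleFreePercolation.ae_exists_not_adj hlam hα hw hwμ]
      with ω hω ⟨a, b, hab, hadj⟩
    obtain ⟨hex, hsupp⟩ := ScaleFreePercolation.connectedComponent_of_edist_le hω
    refine ⟨hex, fun C _ => ?_⟩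
    rw [ScaleFreePercolation.ediam_toSimpleGraph_of_supp_eq_univ (hsupp C)]
    exact le_antisymm (SimpleGraph.ediam_le_of_edist_le hω)
      (ScaleFreePercolation.two_le_ediam hab hadj)
  · have h1 := ae_all_iff.2 fun x => ae_all_iff.2 fun y =>
      ScaleFreePercolation.ae_edist_le_ceil (lam := lam) hd hlam hα hαd hw hwμ x y
    filter_upwards [h1] with ω hω
    obtain ⟨hex, hsupp⟩ := ScaleFreePercolation.connectedComponent_of_edist_le hω
    refine ⟨hex, fun C _ => ?_⟩
    rw [ScaleFreePercolation.ediam_toSimpleGraph_of_supp_eq_univ (hsupp C)]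
    exact SimpleGraph.ediam_le_of_edist_le hω
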